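/- Let $K$ be the Hilbert space of one cavity mode, i.e. a complex Hilbert space with an orthonormal (Hilbert) basis $|n\rangle$, $n=0,1,2,\dots$ (for instance $K=L^2(\mathbb R)$ with the Hermite functions), and let $a|n\rangle=\sqrt n\,|n-1\rangle$ (with $a|0\rangle=0$), $a^*|n\rangle=\sqrt{n+1}\,|n+1\rangle$, $N=a^*a$. Let $\mathbb C^2$, the state space of a two-level atom, have the ordered orthonormal basis $(|{\uparrow}\rangle,|{\downarrow}\rangle)$ of excited and ground state, let $\sigma_1,\sigma_2,\sigma_3$ be the Pauli matrices in this basis, and let $\sigma_\pm=\sigma_1\pm i\sigma_2$. On $\mathcal H=\mathbb C^2\otimes K$ consider the Jaynes–Cummings Hamiltonians $$H_{1}=\tfrac12\,\sigma_3\otimes 1,\qquad H_{2}=\tfrac12\,(\sigma_+\otimes a+\sigma_-\otimes a^*)$$ and the charge operator $$X_1=|{\uparrow}\rangle\langle{\uparrow}|\otimes 1+1\otimes N ,\qquad |{\uparrow}\rangle\langle{\uparrow}|=\tfrac12(1+\sigma_3),$$ each being the closure of the operator given by the expression on the span of the vectors $|{\uparrow}\rangle\otimes|n\rangle$, $|{\downarrow}\rangle\otimes|n\rangle$.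 The eigenvalues of $X_1$ are $\mu=0,1,2,\dots$; the eigenspace $\mathcal H^{(0)}$ is spanned by the vacuum vector $\Omega=|{\downarrow}\rangle\otimes|0\rangle$, and for $\mu\ge1$ the eigenspace $\mathcal H^{(\mu)}$ is spanned by $|{\downarrow}\rangle\otimes|\mu\rangle$ and $|{\uparrow}\rangle\otimes|\mu-1\rangle$. Let $\mathcal U(X_1)$ be the group of unitaries on $\mathcal H$ that commute with $e^{i\alpha X_1}$ for all $\alpha\in\mathbb R$; each $U\in\mathcal U(X_1)$ leaves every $\mathcal H^{(\mu)}$ invariant, and $U^{(\mu)}$ denotes its restriction to $\mathcal H^{(\mu)}$. Let $\mathcal{SU}(X_1)=\{U\in\mathcal U(X_1) : \det U^{(\mu)}=1\text{ for all }\mu\}$. The dynamical group $\mathcal G$ generated by $H_1,H_2$ is the smallest subgroup of the unitary group of $\mathcal H$ that is closed in the unitary group for the strong operator topology and contains $e^{itH_1}$ and $e^{itH_2}$ for all $t\in\mathbb R$. **Theorem.** The dynamical group generated by $H_1$ and $H_2$ is $$\mathcal G=\{U\in\mathcal U(X_1) : \det U^{(\mu)}=1\ \text{ for all } \mu\ge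 1\},$$ that is, it coincides with $\mathcal{SU}(X_1)$ up to an arbitrary phase on the one-dimensional vacuum eigenspace $\mathcal H^{(0)}=\mathbb C\,\Omega$. More precisely, $\mathcal{SU}(X_1)=\{U\in\mathcal G : U\Omega=\Omega\}$. -/

import Mathlib

open scoped TensorProduct

noncomputable section

namespace JaynesCummings

/-! ### Unitary groups, generators, and dynamical groups -/

section General

variable {E : Type*} [NormedAddCommGroup E] [InnerProductSpace ℂ E]

/-- `V t = exp (i t A)` for all real `t`: the family `V` is the strongly continuous one-parameter
group of unitaries whose infinitesimal generator is exactly `i A`. In terms of the graph of `A`: a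
vector `ψ` lies in the domain of `A` with `A ψ = φ` if and only if `t ↦ V t ψ` has derivative `i φ`
at `t = 0`. By Stone's theorem, `V` exists and is unique for each selfadjoint operator `A`. -/
structure IsExpGroup (A : E →ₗ.[ℂ] E) (V : ℝ → (E ≃ₗᵢ[ℂ] E)) : Prop where
  map_zero : V 0 = 1
  map_add : ∀ s t : ℝ, V (s + t) = V s * V t
  continuous : ∀ ψ : E, Continuous fun t : ℝ => V t ψ
  generator : ∀ ψ φ : E,
    (ψ, φ) ∈ A.graph ↔ HasDerivAt (fun t : ℝ => V t ψ) (Complex.I • φ) 0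

/-- The strong operator topology on the group of all unitaries of `E` (that is, of all bijective
linear isometries): the topology of pointwise convergence on vectors. -/
abbrev strongTopology (E : Type*) [NormedAddCommGroup E] [InnerProductSpace ℂ E] :
    TopologicalSpace (E ≃ₗᵢ[ℂ] E) :=
  TopologicalSpace.induced (fun U : E ≃ₗᵢ[ℂ] E => fun ψ : E => U ψ) inferInstance

/-- A set of unitaries is strongly closed: it is closed in the unitary group for the strong operator
topology. -/
def IsStronglyClosed (S : Set (E ≃ₗᵢ[ℂ] E)) : Prop :=
  @IsClosed _ (strongTopology E) S

/-- The dynamical group generated by a family of (selfadjoint) control Hamiltonians `H k`: the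
smallest strongly closed subgroup of the unitary group that contains all unitaries
`exp (i t H k)`, `t` real. -/
def dynamicalGroup {ι : Type*} (H : ι → (E →ₗ.[ℂ] E)) : Subgroup (E ≃ₗᵢ[ℂ] E) :=
  sInf {G : Subgroup (E ≃ₗᵢ[ℂ] E) | IsStronglyClosed (G : Set (E ≃ₗᵢ[ℂ] E)) ∧
    ∀ (k : ι) (V : ℝ → (E ≃ₗᵢ[ℂ] E)), IsExpGroup (H k) V → ∀ t : ℝ, V t ∈ G}

/-- The eigenspace `{ψ ∈ dom X | X ψ = μ ψ}` of an unbounded operator `X`. -/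
def eigenspace (X : E →ₗ.[ℂ] E) (μ : ℤ) : Submodule ℂ E where
  carrier := {ψ | (ψ, (μ : ℂ) • ψ) ∈ X.graph}
  add_mem' := by
    intro ψ φ hψ hφ
    have h := X.graph.add_mem hψ hφ
    simpa only [Set.mem_ofPred_eq, Prod.mk_add_mk, smul_add] using h
  zero_mem' := by
    have h := X.graph.zero_mem
    simpa only [Set.mem_ofPred_eq, smul_zero, Prod.zero_eq_mk] using h
  smul_mem' := by
    intro c ψ hψ
    have h := X.graph.smul_mem c hψ
    simpa only [Set.mem_ofPred_eq, Prod.smul_mk, smul_comm c (μ : ℂ) ψ] using h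

/-- The group `U(X)` of all unitaries that commute with the representation
`exp (i α) ↦ exp (i α X)` of the circle group generated by the charge operator `X`. -/
def unitariesCommutingWith (X : E →ₗ.[ℂ] E) : Set (E ≃ₗᵢ[ℂ] E) :=
  {U | ∀ V : ℝ → (E ≃ₗᵢ[ℂ] E), IsExpGroup X V → ∀ α : ℝ, U * V α = V α * U}

/-- The unitary `U` maps the eigenspace of `X` for the eigenvalue `μ` into itself, and its block
there (its restriction to that eigenspace) has determinant one. The determinant of a linear
endomorphism of the zero space is one. -/
def BlockDetEqOne (X : E →ₗ.[ℂ] E) (μ : ℤ) (U : E ≃ₗᵢ[ℂ] E) : Prop :=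
  ∃ h : ∀ ψ ∈ eigenspace X μ, (U.toLinearEquiv : E →ₗ[ℂ] E) ψ ∈ eigenspace X μ,
    LinearMap.det ((U.toLinearEquiv : E →ₗ[ℂ] E).restrict h) = 1

/-- The group `SU(X)` of all unitaries in `U(X)` all of whose blocks have determinant one, for a
charge operator `X` with integer eigenvalues of finite multiplicity. -/
def specialUnitaries (X : E →ₗ.[ℂ] E) : Set (E ≃ₗᵢ[ℂ] E) :=
  {U | U ∈ unitariesCommutingWith X ∧ ∀ μ : ℤ, BlockDetEqOne X μ U}

end General

/-! ### The atom: Pauli matrices in the ordered basis `(↑, ↓)` -/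

/-- The first Pauli matrix. -/
def pauli1 : Matrix (Fin 2) (Fin 2) ℂ := !![0, 1; 1, 0]

/-- The second Pauli matrix. -/
def pauli2 : Matrix (Fin 2) (Fin 2) ℂ := !![0, -Complex.I; Complex.I, 0]

/-- The third Pauli matrix. -/
def pauli3 : Matrix (Fin 2) (Fin 2) ℂ := !![1, 0; 0, -1]

/-- `σ₊ = σ₁ + i σ₂`. -/
def pauliPlus : Matrix (Fin 2) (Fin 2) ℂ := pauli1 + Complex.I • pauli2

/-- `σ₋ = σ₁ - i σ₂`. -/
def pauliMinus : Matrix (Fin 2) (Fin 2) ℂ := pauli1 - Complex.I • pauli2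

/-- The state space of the two-level atom; the basis vector with index `0` is the excited state
`|↑⟩ = |1⟩`, the one with index `1` is the ground state `|↓⟩ = |0⟩`. -/
abbrev Atom : Type := EuclideanSpace ℂ (Fin 2)

/-! ### The cavity mode: operators on finite linear combinations of number states -/

/-- Finite (formal) linear combinations `∑ cₙ |n⟩` of the number states. -/
abbrev FiniteNumberStates : Type := ℕ →₀ ℂ

/-- The annihilation operator: `a |n⟩ = √n |n - 1⟩` for `n ≥ 1`, and `a |0⟩ = 0`. -/
def annihilation : FiniteNumberStates →ₗ[ℂ] FiniteNumberStates :=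
  Finsupp.linearCombination ℂ fun n : ℕ => Finsupp.single (n - 1) ((Real.sqrt n : ℝ) : ℂ)

/-- The creation operator: `a* |n⟩ = √(n + 1) |n + 1⟩`. -/
def creation : FiniteNumberStates →ₗ[ℂ] FiniteNumberStates :=
  Finsupp.linearCombination ℂ fun n : ℕ => Finsupp.single (n + 1) ((Real.sqrt (n + 1) : ℝ) : ℂ)

/-- The number operator `N = a* a`. -/
def number : FiniteNumberStates →ₗ[ℂ] FiniteNumberStates :=
  creation ∘ₗ annihilation

/-! ### The joint system -/

/-- Finite linear combinations of the vectors `|ν⟩ ⊗ |n⟩`. -/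
abbrev FiniteStates : Type := Atom ⊗[ℂ] FiniteNumberStates

/-- The operator `σ ⊗ B` on finite linear combinations, for a matrix `σ` acting on the atom and an
operator `B` acting on the mode. -/
def tensorOp (σ : Matrix (Fin 2) (Fin 2) ℂ) (B : FiniteNumberStates →ₗ[ℂ] FiniteNumberStates) :
    FiniteStates →ₗ[ℂ] FiniteStates :=
  TensorProduct.map (Matrix.toEuclideanLin σ) B

/-- `(σ₃ ⊗ 1) / 2`. -/
def preJC1 : FiniteStates →ₗ[ℂ] FiniteStates :=
  (1 / 2 : ℂ) • tensorOp pauli3 LinearMap.id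

/-- `(σ₊ ⊗ a + σ₋ ⊗ a*) / 2`. -/
def preJC2 : FiniteStates →ₗ[ℂ] FiniteStates :=
  (1 / 2 : ℂ) • (tensorOp pauliPlus annihilation + tensorOp pauliMinus creation)

/-- `|↑⟩⟨↑| ⊗ 1 + 1 ⊗ N`, where `|↑⟩⟨↑| = (1 + σ₃) / 2`. -/
def preCharge : FiniteStates →ₗ[ℂ] FiniteStates :=
  tensorOp ((1 / 2 : ℂ) • (1 + pauli3)) LinearMap.id + tensorOp 1 number

section Joint

variable {K : Type*} [NormedAddCommGroup K] [InnerProductSpace ℂ K]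

/-- The inclusion of the finite linear combinations of the `|ν⟩ ⊗ |n⟩` into the Hilbert space
`ℂ² ⊗ K`, where `|n⟩ = b n` is the number basis of the Hilbert space `K` of the cavity mode. Since
`ℂ²` is finite-dimensional, the algebraic tensor product is already the Hilbert space tensor
product. -/
def inclusion (b : HilbertBasis ℕ ℂ K) : FiniteStates →ₗ[ℂ] (Atom ⊗[ℂ] K) :=
  (Finsupp.linearCombination ℂ (fun n : ℕ => b n)).lTensor Atom

theorem inclusion_injective (b : HilbertBasis ℕ ℂ K) : Function.Injective (inclusion b) :=
  Module.Flat.lTensor_preserves_injective_linearMap _ b.orthonormal.linearIndependent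

/-- The operator `T`, viewed as an operator in the Hilbert space `ℂ² ⊗ K` with domain
`D = span {|ν⟩ ⊗ |n⟩}`. -/
def onFiniteStates (b : HilbertBasis ℕ ℂ K) (T : FiniteStates →ₗ[ℂ] FiniteStates) :
    (Atom ⊗[ℂ] K) →ₗ.[ℂ] (Atom ⊗[ℂ] K) where
  domain := LinearMap.range (inclusion b)
  toFun := inclusion b ∘ₗ T ∘ₗ
    ((LinearEquiv.ofInjective (inclusion b) (inclusion_injective b)).symm :
      LinearMap.range (inclusion b) →ₗ[ℂ] FiniteStates)

/-- The control Hamiltonians `(σ₃ ⊗ 1) / 2` (index `0`) and `(σ₊ ⊗ a + σ₋ ⊗ a*) / 2` (index `1`):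
the closures of the operators with these expressions on `D = span {|ν⟩ ⊗ |n⟩}`. -/
def hamiltonian (b : HilbertBasis ℕ ℂ K) : Fin 2 → ((Atom ⊗[ℂ] K) →ₗ.[ℂ] (Atom ⊗[ℂ] K)) :=
  ![(onFiniteStates b preJC1).closure, (onFiniteStates b preJC2).closure]

/-- The charge operator `X₁ = |↑⟩⟨↑| ⊗ 1 + 1 ⊗ N`: the closure of the operator with this expression
on `D = span {|ν⟩ ⊗ |n⟩}`. -/
def charge (b : HilbertBasis ℕ ℂ K) : (Atom ⊗[ℂ] K) →ₗ.[ℂ] (Atom ⊗[ℂ] K) :=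
  (onFiniteStates b preCharge).closure

/-- The vacuum vector: the atom is in its ground state `|↓⟩` and the mode is in the number
state `|0⟩`. It spans the eigenspace of `X₁` for the eigenvalue zero. -/
def vacuum (b : HilbertBasis ℕ ℂ K) : Atom ⊗[ℂ] K :=
  EuclideanSpace.single (1 : Fin 2) (1 : ℂ) ⊗ₜ[ℂ] b 0

end Joint

end JaynesCummings

end

/-! ### One-parameter groups in a closed submonoid of a Banach algebra. -/

section ClosedSubmonoid

open Filter Topology NormedSpace


/-! Both Hamiltonians preserve the charge eigenspaces. On the block spanned by `|↑⟩ ⊗ |n⟩` and `|↓⟩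
⊗ |n + 1⟩` they are the traceless matrices `σ₃ / 2` and `√(n + 1) σ₁`; on the vacuum they are `-1 /
2` and `0`. Their flows therefore lie in `blockGroup`: determinant one on every two-dimensional
block, any phase on the vacuum. This group is strongly closed, which bounds the dynamical group from
above.

For the converse, SU(2) is identified with the unit quaternions. The coupling flow turns block `n`
about the axis `i` with speed `√(n + 1)`; its conjugate by a spin rotation does so about `j`, and
both fix the vacuum. On finitely many blocks, iterated commutators of these generators yield `p(r²)
r` times `i` or `j` for every polynomial `p`, where `r` is the tuple of speeds. The speeds being
positive and distinct, Lagrange interpolation controls the blocks independently, so every tuple of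
unit quaternions is a limit of realizable ones (`Quaternion.mem_of_isClosed_of_exp_mem`). Since
strong convergence of unitaries can be tested on basis vectors, approximation on ever more blocks
suffices, whatever happens on the others (`mem_of_fixes_vacuum`). The spin flow then supplies the
vacuum phase (`blockGroup_le`).

Finally, commuting with the charge flow kills matrix elements between different eigenvalues, and a
unitary block of determinant one is a unit quaternion; this identifies `blockGroup` with the stated
group (`mem_blockGroup_iff`). -/

theorem norm_pow_sub_pow_le_of_norm_le {A : Type*} [NormedRing A] {x y : A} {M : ℝ} (hM : 1 ≤ M) (hx : ‖x‖ ≤ M) (hy : ‖y‖ ≤ M)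
    (h1 : ‖(1 : A)‖ ≤ 1) (n : ℕ) : ‖x ^ n - y ^ n‖ ≤ n * M ^ n * ‖x - y‖ := by
  have hM0 : 0 ≤ M := zero_le_one.trans hM
  have hp : ∀ k : ℕ, ‖y ^ k‖ ≤ M ^ k := by
    intro k
    induction k with
    | zero => simpa using h1
    | succ k ih =>
      rw [pow_succ, pow_succ]
      exact (norm_mul_le _ _).trans (mul_le_mul ih hy (norm_nonneg _) (by positivity))
  induction n with
  | zero => simp
  | succ n ih =>
    have hid : x ^ (n + 1) - y ^ (n + 1) = x * (x ^ n - y ^ n) + (x - y) * y ^ n := by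
      rw [pow_succ' x, pow_succ' y]; noncomm_ring
    rw [hid]
    have e1 : ‖x * (x ^ n - y ^ n)‖ ≤ M * (n * M ^ n * ‖x - y‖) :=
      (norm_mul_le _ _).trans (mul_le_mul hx ih (norm_nonneg _) hM0)
    have e2 : ‖(x - y) * y ^ n‖ ≤ ‖x - y‖ * M ^ (n + 1) :=
      (norm_mul_le _ _).trans (mul_le_mul_of_nonneg_left
        ((hp n).trans (pow_le_pow_right₀ hM (Nat.le_succ n))) (norm_nonneg _))
    calc _ ≤ _ := (norm_add_le _ _).trans (add_le_add e1 e2)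
      _ = _ := by push_cast; ring

variable {A : Type*} [NormedRing A] [NormedAlgebra ℝ A]

theorem hasDerivAt_exp_smul_zero [CompleteSpace A] (a : A) :
    HasDerivAt (fun t : ℝ => exp (t • a)) a 0 := by
  simpa using hasDerivAt_exp_smul_const (𝕂 := ℝ) a (0 : ℝ)

/-- A differentiable curve through `1` has its exponential as a limit of powers. -/
theorem tendsto_pow_exp_of_hasDerivAt [CompleteSpace A] [NormOneClass A] {γ : ℝ → A} {a : A}
    (h0 : γ 0 = 1) (hγ : HasDerivAt γ a 0) :
    Tendsto (fun n : ℕ => γ ((n : ℝ)⁻¹) ^ n) atTop (𝓝 (exp a)) := by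
  let : NormedAlgebra ℚ A := NormedAlgebra.restrictScalars ℚ ℝ A
  have he := hasDerivAt_exp_smul_zero a
  have hinv : Tendsto (fun n : ℕ => ((n : ℝ)⁻¹)) atTop (𝓝[≠] 0) := by
    refine tendsto_nhdsWithin_iff.2 ⟨tendsto_inv_atTop_nhds_zero_nat, ?_⟩
    filter_upwards [eventually_gt_atTop 0] with n hn
    simp; omega
  -- The two curves agree to first order at `0`, so they differ by `o(1 / n)` at time `1 / n`.
  have hdiff : Tendsto (fun n : ℕ => (n : ℝ) * ‖γ ((n : ℝ)⁻¹) - exp ((n : ℝ)⁻¹ • a)‖) atTop (𝓝 0) := by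
    have h := (hasDerivAt_iff_tendsto_slope.1 (hγ.sub he)).comp hinv
    rw [sub_self] at h
    refine h.norm.congr' ?_ |>.trans (by simp)
    filter_upwards with n
    simp [slope, h0, norm_smul]
  set C : ℝ := ‖a‖ + 1
  have hb : ∀ δ : ℝ → A, δ 0 = 1 → HasDerivAt δ a 0 →
      ∀ᶠ n : ℕ in atTop, ‖δ ((n : ℝ)⁻¹)‖ ≤ Real.exp (C * (n : ℝ)⁻¹) := by
    intro δ hδ0 hδ
    have h := ((hasDerivAt_iff_tendsto_slope.1 hδ).comp hinv).norm
    have hlt : ‖a‖ < C := by simp [C]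
    filter_upwards [h.eventually (eventually_lt_nhds hlt), eventually_gt_atTop 0] with n hn hn0
    have hn0' : (0 : ℝ) < n := by exact_mod_cast hn0
    have hs : ‖δ ((n : ℝ)⁻¹) - 1‖ ≤ C * (n : ℝ)⁻¹ := by
      have : (n : ℝ) * ‖δ ((n : ℝ)⁻¹) - 1‖ < C := by
        simpa [slope, hδ0, norm_smul] using hn
      rw [← div_eq_mul_inv, le_div_iff₀ hn0']
      linarith
    calc ‖δ ((n : ℝ)⁻¹)‖ = ‖1 + (δ ((n : ℝ)⁻¹) - 1)‖ := by simp
      _ ≤ 1 + C * (n : ℝ)⁻¹ := (norm_add_le _ _).trans (by rw [norm_one]; linarith)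
      _ ≤ _ := by linarith [Real.add_one_le_exp (C * (n : ℝ)⁻¹)]
  rw [tendsto_iff_norm_sub_tendsto_zero]
  have hlim := hdiff.const_mul (Real.exp C)
  rw [mul_zero] at hlim
  refine squeeze_zero' (Eventually.of_forall fun _ => norm_nonneg _) ?_ hlim
  filter_upwards [hb γ h0 hγ, hb _ (by simp) he, eventually_gt_atTop 0] with n h1 h2 hn0
  have hn0' : (n : ℝ) ≠ 0 := by exact_mod_cast hn0.ne'
  have hea : exp a = exp ((n : ℝ)⁻¹ • a) ^ n := by
    rw [← exp_nsmul, ← Nat.cast_smul_eq_nsmul ℝ, smul_smul, mul_inv_cancel₀ hn0', one_smul]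
  -- With this bound `M` on both factors, `M ^ n = exp C` does not depend on `n`.
  have hM : 1 ≤ Real.exp (C * (n : ℝ)⁻¹) := Real.one_le_exp (by positivity)
  have := norm_pow_sub_pow_le_of_norm_le hM h1 h2 norm_one.le n
  rw [← Real.exp_nat_mul, mul_left_comm, mul_inv_cancel₀ hn0', mul_one] at this
  rw [hea]
  calc _ ≤ _ := this
    _ = _ := by ring

/-- Rescaling the parameter by `t` makes the exponential a limit of powers of elements of `G`. Hence
only the tangent of a curve in `G` has to be known, not its group law. -/
theorem exp_smul_mem_of_hasDerivAt [CompleteSpace A] [NormOneClass A] {G : Submonoid A}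
    (hG : IsClosed (G : Set A)) {γ : ℝ → A} {a : A} (hmem : ∀ s, γ s ∈ G)
    (h0 : γ 0 = 1) (hγ : HasDerivAt γ a 0) (t : ℝ) : exp (t • a) ∈ G := by
  have hγt : HasDerivAt (fun s => γ (s * t)) (t • a) 0 := by
    have h1 : HasDerivAt (fun s : ℝ => s * t) t 0 := by simpa using (hasDerivAt_id (0 : ℝ)).mul_const t
    exact HasDerivAt.scomp (g₁ := γ) 0 (by simpa using hγ) h1
  refine hG.mem_of_tendsto (tendsto_pow_exp_of_hasDerivAt (by simpa using h0) hγt) ?_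
  exact Eventually.of_forall fun n => G.pow_mem (hmem _) n

/-- The infinitesimal generators of the one-parameter groups lying in a closed submonoid of a
Banach algebra. -/
def Submonoid.generators [CompleteSpace A] [NormOneClass A] (G : Submonoid A)
    (hG : IsClosed (G : Set A)) : Submodule ℝ A where
  carrier := {a | ∀ t : ℝ, exp (t • a) ∈ G}
  zero_mem' t := by simp
  add_mem' {a b} ha hb t := by
    -- Lie product formula: this curve in `G` has tangent `a + b`.
    refine exp_smul_mem_of_hasDerivAt hG (γ := fun s : ℝ => exp (s • a) * exp (s • b))
      (fun s => G.mul_mem (ha s) (hb s)) (by simp) ?_ t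
    simpa using (hasDerivAt_exp_smul_zero a).fun_mul (hasDerivAt_exp_smul_zero b)
  smul_mem' c a ha t := by
    rw [smul_smul]
    exact ha _

/-- The commutator is the derivative at `0` of `s ↦ exp (s a) b exp (-s a)`. This curve consists of
generators, which form a closed real subspace, so its difference quotients and their limit are
generators as well. -/
theorem Submonoid.lie_mem_generators [CompleteSpace A] [NormOneClass A] {G : Submonoid A}
    (hG : IsClosed (G : Set A)) {a b : A} (ha : a ∈ G.generators hG) (hb : b ∈ G.generators hG) :
    a * b - b * a ∈ G.generators hG := by
  let : NormedAlgebra ℚ A := NormedAlgebra.restrictScalars ℚ ℝ A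
  have hclosed : IsClosed (G.generators hG : Set A) := by
    have : (G.generators hG : Set A) = ⋂ t : ℝ, (fun a : A => exp (t • a)) ⁻¹' G := by
      ext; simp [Submonoid.generators]
    rw [this]
    exact isClosed_iInter fun t => hG.preimage (exp_continuous.comp (continuous_const_smul t))
  have hconj : ∀ s : ℝ, exp (s • a) * b * exp (s • -a) ∈ G.generators hG := by
    intro s t
    have hu : exp (s • a) * exp (s • -a) = 1 := by
      rw [← exp_add_of_commute (by simp [Commute, SemiconjBy])]; simp
    have hu' : exp (s • -a) * exp (s • a) = 1 := by
      rw [← exp_add_of_commute (by simp [Commute, SemiconjBy])]; simp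
    have := exp_units_conj (⟨_, _, hu, hu'⟩ : Aˣ) (t • b)
    simp only [Units.inv_mk, mul_smul_comm, smul_mul_assoc] at this
    rw [this]
    have hneg : exp (s • -a) ∈ G := by simpa using ha (-s)
    exact G.mul_mem (G.mul_mem (ha s) (hb t)) hneg
  have hd : HasDerivAt (fun s : ℝ => exp (s • a) * b * exp (s • -a)) (a * b - b * a) 0 := by
    have := ((hasDerivAt_exp_smul_zero a).mul_const b).fun_mul (hasDerivAt_exp_smul_zero (-a))
    simpa [sub_eq_add_neg] using this
  refine hclosed.mem_of_tendsto (hasDerivAt_iff_tendsto_slope.1 hd) (Eventually.of_forall fun s => ?_)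
  rw [slope]
  refine Submodule.smul_mem _ _ (Submodule.sub_mem _ (hconj s) (hconj 0))

end ClosedSubmonoid

/-! ### Simultaneous control of finitely many unit quaternions. -/

section Quaternion

open NormedSpace Quaternion

/-- The quaternion unit `i`. -/
def Quaternion.unitI : ℍ[ℝ] := ⟨0, 1, 0, 0⟩

/-- The quaternion unit `j`. -/
def Quaternion.unitJ : ℍ[ℝ] := ⟨0, 0, 1, 0⟩

/-- The quaternion unit `k`. -/
def Quaternion.unitK : ℍ[ℝ] := ⟨0, 0, 0, 1⟩

@[simp] theorem Quaternion.unitI_re : unitI.re = 0 := rfl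
@[simp] theorem Quaternion.unitI_imI : unitI.imI = 1 := rfl
@[simp] theorem Quaternion.unitI_imJ : unitI.imJ = 0 := rfl
@[simp] theorem Quaternion.unitI_imK : unitI.imK = 0 := rfl
@[simp] theorem Quaternion.unitJ_re : unitJ.re = 0 := rfl
@[simp] theorem Quaternion.unitJ_imI : unitJ.imI = 0 := rfl
@[simp] theorem Quaternion.unitJ_imJ : unitJ.imJ = 1 := rfl
@[simp] theorem Quaternion.unitJ_imK : unitJ.imK = 0 := rfl
@[simp] theorem Quaternion.unitK_re : unitK.re = 0 := rfl
@[simp] theorem Quaternion.unitK_imI : unitK.imI = 0 := rfl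
@[simp] theorem Quaternion.unitK_imJ : unitK.imJ = 0 := rfl
@[simp] theorem Quaternion.unitK_imK : unitK.imK = 1 := rfl

theorem Quaternion.norm_unitI : ‖unitI‖ = 1 := by
  have h : ‖unitI‖ * ‖unitI‖ = 1 := by
    rw [← normSq_eq_norm_mul_self, normSq_def']; simp
  nlinarith [norm_nonneg unitI]

theorem Quaternion.norm_unitJ : ‖unitJ‖ = 1 := by
  have h : ‖unitJ‖ * ‖unitJ‖ = 1 := by
    rw [← normSq_eq_norm_mul_self, normSq_def']; simp
  nlinarith [norm_nonneg unitJ]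

theorem Quaternion.exists_exp_eq_of_norm_eq_one {q : ℍ[ℝ]} (hq : ‖q‖ = 1) :
    ∃ v : ℍ[ℝ], v.re = 0 ∧ exp v = q := by
  have hsq : q.re ^ 2 + ‖q.im‖ ^ 2 = 1 := by
    have h1 : normSq q = 1 := by rw [normSq_eq_norm_mul_self, hq, one_mul]
    have h2 : ‖q.im‖ * ‖q.im‖ = normSq q.im := (normSq_eq_norm_mul_self _).symm
    rw [normSq_def'] at h1 h2
    simp at h2
    nlinarith
  by_cases him : q.im = 0
  · have hre : q.re = 1 ∨ q.re = -1 := by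
      rw [him] at hsq
      exact sq_eq_one_iff.1 (by simpa using hsq)
    have hq' : q = (q.re : ℍ[ℝ]) := by simpa [him] using (re_add_im q).symm
    rcases hre with h | h
    · exact ⟨0, by simp, by rw [hq', h]; simp⟩
    -- At `-1` the imaginary part gives no axis, so `i` is chosen arbitrarily.
    · refine ⟨Real.pi • unitI, by simp, ?_⟩
      have hn : ‖Real.pi • unitI‖ = Real.pi := by
        rw [norm_smul, norm_unitI, mul_one, Real.norm_of_nonneg Real.pi_pos.le]
      rw [exp_of_re_eq_zero _ (by simp), hn, hq', h]
      simp
  · have hpos : 0 < ‖q.im‖ := norm_pos_iff.2 him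
    have hle : -1 ≤ q.re ∧ q.re ≤ 1 := abs_le.1 (abs_le_of_sq_le_sq (by nlinarith) zero_le_one)
    -- Polar form: the axis is that of `q.im`, the angle is `arccos q.re`.
    refine ⟨(Real.arccos q.re / ‖q.im‖) • q.im, by simp, ?_⟩
    have hn : ‖(Real.arccos q.re / ‖q.im‖) • q.im‖ = Real.arccos q.re := by
      rw [norm_smul, Real.norm_of_nonneg (div_nonneg (Real.arccos_nonneg _) hpos.le),
        div_mul_cancel₀ _ hpos.ne']
    have hsin : Real.sin (Real.arccos q.re) = ‖q.im‖ := by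
      rw [Real.sin_arccos, show 1 - q.re ^ 2 = ‖q.im‖ ^ 2 by linarith, Real.sqrt_sq hpos.le]
    have harc : Real.arccos q.re ≠ 0 := by
      intro h
      rw [h, Real.sin_zero] at hsin
      exact hpos.ne hsin
    rw [exp_of_re_eq_zero _ (by simp), hn, Real.cos_arccos hle.1 hle.2, hsin, smul_smul,
      show ‖q.im‖ / Real.arccos q.re * (Real.arccos q.re / ‖q.im‖) = 1 by field_simp,
      one_smul, re_add_im]

variable {ι : Type*} [Fintype ι] [Nonempty ι]

/-- A closed submonoid of a power of the quaternions that contains simultaneous rotations about two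
axes, with distinct positive speeds in the factors, contains all tuples of unit quaternions. -/
theorem Quaternion.mem_of_isClosed_of_exp_mem {G : Submonoid (ι → ℍ[ℝ])}
    (hG : IsClosed (G : Set (ι → ℍ[ℝ]))) {r : ι → ℝ} (hr : ∀ k, 0 < r k)
    (hinj : Function.Injective r)
    (hI : ∀ t : ℝ, (fun k => exp (t • r k • unitI)) ∈ G)
    (hJ : ∀ t : ℝ, (fun k => exp (t • r k • unitJ)) ∈ G)
    (q : ι → ℍ[ℝ]) (hq : ∀ k, ‖q k‖ = 1) : q ∈ G := by
  set L := G.generators hG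
  have hexp : ∀ a : ι → ℍ[ℝ], exp a = fun k => exp (a k) := fun a => by
    let _ : NormedAlgebra ℚ ℍ[ℝ] := NormedAlgebra.restrictScalars ℚ ℝ ℍ[ℝ]
    exact Pi.exp_def a
  have hIr : (fun k => r k • unitI) ∈ L := fun t => by rw [hexp]; exact hI t
  have hJr : (fun k => r k • unitJ) ∈ L := fun t => by rw [hexp]; exact hJ t
  -- Commutators multiply coefficients factor by factor; the factor `1 / 2` offsets `i j - j i = 2
  -- k`.
  have hIJ : ∀ c d : ι → ℝ, (fun k => c k • unitI) ∈ L → (fun k => d k • unitJ) ∈ L →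
      (fun k => (c k * d k) • unitK) ∈ L := by
    intro c d hc hd
    convert L.smul_mem (1 / 2 : ℝ) (Submonoid.lie_mem_generators hG hc hd) using 1
    ext k <;> simp; try ring
  have hJK : ∀ c d : ι → ℝ, (fun k => c k • unitJ) ∈ L → (fun k => d k • unitK) ∈ L →
      (fun k => (c k * d k) • unitI) ∈ L := by
    intro c d hc hd
    convert L.smul_mem (1 / 2 : ℝ) (Submonoid.lie_mem_generators hG hc hd) using 1
    ext k <;> simp; try ring
  have hKI : ∀ c d : ι → ℝ, (fun k => c k • unitK) ∈ L → (fun k => d k • unitI) ∈ L →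
      (fun k => (c k * d k) • unitJ) ∈ L := by
    intro c d hc hd
    convert L.smul_mem (1 / 2 : ℝ) (Submonoid.lie_mem_generators hG hc hd) using 1
    ext k <;> simp; try ring
  -- Bracketing twice with `r i` or `r j` returns to the same axis and multiplies the coefficient by
  -- `r²`, which raises the degree of the polynomial by one.
  have hpoly : ∀ p : Polynomial ℝ, (fun k => (p.eval (r k ^ 2) * r k) • unitI) ∈ L ∧
      (fun k => (p.eval (r k ^ 2) * r k) • unitJ) ∈ L := by
    intro p
    induction p using Polynomial.induction_on with
    | C a =>
      constructor
      · convert L.smul_mem a hIr using 1; ext1 k; simp [smul_smul]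
      · convert L.smul_mem a hJr using 1; ext1 k; simp [smul_smul]
    | add p p' hp hp' =>
      constructor
      · convert L.add_mem hp.1 hp'.1 using 1; ext1 k; simp [add_mul, add_smul]
      · convert L.add_mem hp.2 hp'.2 using 1; ext1 k; simp [add_mul, add_smul]
    | monomial n a ih =>
      have hK := hIJ _ _ ih.1 hJr
      constructor
      · convert hJK _ _ hJr hK using 1
        ext1 k
        simp only [Polynomial.eval_mul, Polynomial.eval_C, Polynomial.eval_pow, Polynomial.eval_X]
        congr 1; ring
      · convert hKI _ _ hK hIr using 1
        ext1 k
        simp only [Polynomial.eval_mul, Polynomial.eval_C, Polynomial.eval_pow, Polynomial.eval_X]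
        congr 1; ring
  have hall : ∀ c : ι → ℝ, (fun k => c k • unitI) ∈ L ∧ (fun k => c k • unitJ) ∈ L := by
    classical
    intro c
    -- Positivity makes the squares `r k ^ 2` distinct interpolation nodes; dividing the target
    -- values by `r k` compensates the remaining odd factor.
    have hs : Set.InjOn (fun k => r k ^ 2) (Finset.univ : Finset ι) := fun a _ b _ hab =>
      hinj ((sq_eq_sq₀ (hr a).le (hr b).le).1 hab)
    have he : ∀ k, (Lagrange.interpolate Finset.univ (fun k => r k ^ 2)
        (fun k => c k / r k)).eval (r k ^ 2) * r k = c k := by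
      intro k
      have := Lagrange.eval_interpolate_at_node (fun k => c k / r k) hs (Finset.mem_univ k)
      rw [this, div_mul_cancel₀ _ (hr k).ne']
    have hp := hpoly (Lagrange.interpolate Finset.univ (fun k => r k ^ 2) (fun k => c k / r k))
    rw [funext fun k => congrArg (· • unitI) (he k), funext fun k => congrArg (· • unitJ) (he k)] at hp
    exact hp
  choose v hv hvq using fun k => exists_exp_eq_of_norm_eq_one (hq k)
  have hvL : v ∈ L := by
    have hK : (fun k => ((1 : ℝ) * (v k).imK) • unitK) ∈ L :=
      hIJ (fun _ => 1) _ (hall _).1 (hall _).2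
    convert L.add_mem (L.add_mem (hall fun k => (v k).imI).1 (hall fun k => (v k).imJ).2) hK using 1
    ext k <;> simp [hv]
  have := hvL 1
  rw [one_smul, hexp] at this
  simpa only [hvq] using this

end Quaternion

/-! ### Diagonal unitaries in a Hilbert basis and their generators. -/

section Diagonal

open Filter Topology JaynesCummings

variable {E : Type*} [NormedAddCommGroup E] [InnerProductSpace ℂ E] {ι : Type*}

theorem HilbertBasis.ext_inner (g : HilbertBasis ι ℂ E) {ψ φ : E}
    (h : ∀ j, inner ℂ (g j) ψ = inner ℂ (g j) φ) : ψ = φ :=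
  g.repr.injective (lp.ext (funext fun j => by simpa [g.repr_apply_apply] using h j))

theorem HilbertBasis.inner_eq_zero_of_ne (g : HilbertBasis ι ℂ E) {j k : ι} (h : j ≠ k) :
    inner ℂ (g j) (g k) = 0 :=
  g.orthonormal.2 h

theorem HilbertBasis.inner_self_eq_one (g : HilbertBasis ι ℂ E) (j : ι) :
    inner ℂ (g j) (g j) = (1 : ℂ) := by
  rw [inner_self_eq_norm_sq_to_K, g.orthonormal.1 j]; simp

theorem HilbertBasis.dense_span_range (g : HilbertBasis ι ℂ E) :
    Dense (Submodule.span ℂ (Set.range g) : Set E) :=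
  (Submodule.dense_iff_topologicalClosure_eq_top).2 g.dense_span

/-- Strong convergence of unitaries may be checked on a Hilbert basis. -/
theorem HilbertBasis.tendsto_apply_of_forall {α : Type*} {l : Filter α} (g : HilbertBasis ι ℂ E)
    {U : α → (E ≃ₗᵢ[ℂ] E)} {U₀ : E ≃ₗᵢ[ℂ] E}
    (h : ∀ j, Tendsto (fun a => U a (g j)) l (𝓝 (U₀ (g j)))) (ψ : E) :
    Tendsto (fun a => U a ψ) l (𝓝 (U₀ ψ)) := by
  have hspan : ∀ φ ∈ Submodule.span ℂ (Set.range g),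
      Tendsto (fun a => U a φ) l (𝓝 (U₀ φ)) := by
    intro φ hφ
    induction hφ using Submodule.span_induction with
    | mem x hx => obtain ⟨j, rfl⟩ := hx; exact h j
    | zero => simpa using tendsto_const_nhds
    | add x y _ _ hx hy => simpa using hx.add hy
    | smul c x _ hx => simpa using hx.const_smul c
  rw [Metric.tendsto_nhds]
  intro ε hε
  obtain ⟨φ, hφ, hd⟩ := Metric.mem_closure_iff.1 (g.dense_span_range ψ) (ε / 3) (by positivity)
  filter_upwards [Metric.tendsto_nhds.1 (hspan φ hφ) (ε / 3) (by positivity)] with a ha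
  calc dist (U a ψ) (U₀ ψ) ≤ dist (U a ψ) (U a φ) + dist (U a φ) (U₀ φ) + dist (U₀ φ) (U₀ ψ) :=
        dist_triangle4 _ _ _ _
    _ < ε / 3 + ε / 3 + ε / 3 := by
        rw [(U a).dist_map, (U₀).dist_map, dist_comm φ ψ]; gcongr
    _ = ε := by ring

theorem HilbertBasis.unitary_ext (g : HilbertBasis ι ℂ E) {U V : E ≃ₗᵢ[ℂ] E}
    (h : ∀ j, U (g j) = V (g j)) : U = V := by
  ext ψ
  have := g.tendsto_apply_of_forall (l := (⊤ : Filter Unit)) (U := fun _ => U) (U₀ := V)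
    (fun j => by rw [h j]; exact tendsto_const_nhds) ψ
  exact tendsto_nhds_unique tendsto_const_nhds this

theorem norm_exp_ofReal_mul_I_eq_one (x : ℝ) : ‖Complex.exp (Complex.I * x)‖ = 1 := by
  rw [mul_comm]; exact Complex.norm_exp_ofReal_mul_I x

variable [CompleteSpace E]

/-- The unitary that is diagonal in the Hilbert basis `g`, with phases `exp (i θ j)`. -/
noncomputable def HilbertBasis.diagonal (g : HilbertBasis ι ℂ E) (θ : ι → ℝ) : E ≃ₗᵢ[ℂ] E :=
  g.repr.trans (HilbertBasis.mk (v := fun j => Complex.exp (Complex.I * θ j) • g j)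
    (by
      classical
      rw [orthonormal_iff_ite]
      intro i j
      split_ifs with h
      · subst h
        simp only [inner_smul_left, inner_smul_right, g.inner_self_eq_one, mul_one]
        rw [Complex.mul_conj', norm_exp_ofReal_mul_I_eq_one]
        simp
      · simp [inner_smul_left, inner_smul_right, g.inner_eq_zero_of_ne h])
    (by
      rw [← g.dense_span]
      refine Submodule.topologicalClosure_mono (Submodule.span_le.2 ?_)
      rintro _ ⟨j, rfl⟩
      have : g j = (Complex.exp (Complex.I * θ j))⁻¹ • Complex.exp (Complex.I * θ j) • g j := by
        rw [smul_smul, inv_mul_cancel₀ (Complex.exp_ne_zero _), one_smul]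
      rw [this]
      exact Submodule.smul_mem _ _ (Submodule.subset_span ⟨j, rfl⟩))).repr.symm

@[simp]
theorem HilbertBasis.diagonal_apply_self (g : HilbertBasis ι ℂ E) (θ : ι → ℝ) (j : ι) :
    g.diagonal θ (g j) = Complex.exp (Complex.I * θ j) • g j := by
  classical
  rw [diagonal, LinearIsometryEquiv.trans_apply, g.repr_self, HilbertBasis.repr_symm_single,
    HilbertBasis.coe_mk]

theorem HilbertBasis.inner_diagonal (g : HilbertBasis ι ℂ E) (θ : ι → ℝ) (j : ι) (ψ : E) :
    inner ℂ (g j) (g.diagonal θ ψ) = Complex.exp (Complex.I * θ j) * inner ℂ (g j) ψ := by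
  have h1 := (g.diagonal θ).inner_map_map (g j) ψ
  rw [diagonal_apply_self, inner_smul_left] at h1
  rw [← h1, ← mul_assoc, Complex.mul_conj, Complex.normSq_eq_norm_sq, norm_exp_ofReal_mul_I_eq_one]
  simp

theorem HilbertBasis.continuous_diagonal (g : HilbertBasis ι ℂ E) (lam : ι → ℝ) (ψ : E) :
    Continuous fun t : ℝ => g.diagonal (fun j => t * lam j) ψ := by
  refine continuous_iff_continuousAt.2 fun t => g.tendsto_apply_of_forall (fun j => ?_) ψ
  simp only [diagonal_apply_self]
  refine Continuous.tendsto (f := fun s : ℝ => Complex.exp (Complex.I * ↑(s * lam j)) • g j) ?_ t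
  fun_prop

/-- The eigenvalues may be unbounded, so the expansion is not differentiated term by term. Instead
`V t ψ = ψ + ∫ i V s φ ds` is checked in each coordinate, and the fundamental theorem of calculus
applies because the integrand is norm continuous. -/
theorem HilbertBasis.hasDerivAt_diagonal (g : HilbertBasis ι ℂ E) {lam : ι → ℝ} {ψ φ : E}
    (h : ∀ j, inner ℂ (g j) φ = lam j * inner ℂ (g j) ψ) :
    HasDerivAt (fun t : ℝ => g.diagonal (fun j => t * lam j) ψ) (Complex.I • φ) 0 := by
  have hc : Continuous fun s : ℝ => Complex.I • g.diagonal (fun j => s * lam j) φ :=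
    (g.continuous_diagonal lam φ).const_smul _
  have hint : ∀ t : ℝ, g.diagonal (fun j => t * lam j) ψ =
      ψ + ∫ s in (0 : ℝ)..t, Complex.I • g.diagonal (fun j => s * lam j) φ := by
    intro t
    refine g.ext_inner fun j => ?_
    have hcomm := (innerSL ℂ (g j)).intervalIntegral_comp_comm (hc.intervalIntegrable
      (μ := MeasureTheory.volume) 0 t)
    simp only [innerSL_apply_apply] at hcomm
    rw [inner_add_right, ← hcomm, g.inner_diagonal]
    have hd : ∀ s ∈ Set.uIcc 0 t, HasDerivAt
        (fun s : ℝ => Complex.exp (Complex.I * ↑(s * lam j)) * inner ℂ (g j) ψ)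
        (inner ℂ (g j) (Complex.I • g.diagonal (fun j => s * lam j) φ)) s := by
      intro s _
      have h1 : HasDerivAt (fun s : ℝ => Complex.I * ↑(s * lam j)) (Complex.I * lam j) s := by
        have h2 : HasDerivAt (fun s : ℝ => s * lam j) (lam j) s := by
          simpa using (hasDerivAt_id s).mul_const (lam j)
        exact h2.ofReal_comp.const_mul _
      refine ((h1.cexp).mul_const (inner ℂ (g j) ψ)).congr_deriv ?_
      rw [inner_smul_right, g.inner_diagonal, h j]
      ring
    rw [intervalIntegral.integral_eq_sub_of_hasDerivAt hd]
    · simp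
    · have : Continuous fun s : ℝ => inner ℂ (g j) (Complex.I • g.diagonal (fun j => s * lam j) φ) :=
        continuous_const.inner hc
      exact this.intervalIntegrable 0 t
  have hz : g.diagonal (fun j => (0 : ℝ) * lam j) φ = φ :=
    g.ext_inner fun j => by rw [g.inner_diagonal]; simp
  have hd := (intervalIntegral.integral_hasDerivAt_right (hc.intervalIntegrable
    (μ := MeasureTheory.volume) 0 0) (hc.stronglyMeasurableAtFilter _ _) hc.continuousAt).const_add ψ
  rw [hz] at hd
  exact hd.congr_of_eventuallyEq (Eventually.of_forall hint)

omit [CompleteSpace E] in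
-- The coordinate relation is a closed condition on pairs. Conversely, a pair satisfying it is the
-- limit of its finite partial sums, taken over the same indices in both components.
theorem HilbertBasis.topologicalClosure_graph (g : HilbertBasis ι ℂ E) {lam : ι → ℝ}
    {T : E →ₗ.[ℂ] E} (hdom : T.domain ≤ Submodule.span ℂ (Set.range g))
    (hT : ∀ j, (g j, (lam j : ℂ) • g j) ∈ T.graph) (ψ φ : E) :
    (ψ, φ) ∈ T.graph.topologicalClosure ↔ ∀ j, inner ℂ (g j) φ = lam j * inner ℂ (g j) ψ := by
  constructor
  · have hmem : ∀ ψ ∈ Submodule.span ℂ (Set.range g), ∃ φ, (ψ, φ) ∈ T.graph ∧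
        ∀ j, inner ℂ (g j) φ = lam j * inner ℂ (g j) ψ := by
      intro ψ hψ
      induction hψ using Submodule.span_induction with
      | mem x hx =>
        obtain ⟨k, rfl⟩ := hx
        refine ⟨_, hT k, fun j => ?_⟩
        rw [inner_smul_right]
        by_cases hjk : j = k
        · rw [hjk]
        · rw [g.inner_eq_zero_of_ne hjk]; simp
      | zero => exact ⟨0, T.graph.zero_mem, by simp⟩
      | add x y _ _ hx hy =>
        obtain ⟨φ, h1, h2⟩ := hx
        obtain ⟨φ', h1', h2'⟩ := hy
        exact ⟨φ + φ', T.graph.add_mem h1 h1', fun j => by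
          rw [inner_add_right, inner_add_right, h2, h2']; ring⟩
      | smul c x _ hx =>
        obtain ⟨φ, h1, h2⟩ := hx
        exact ⟨c • φ, T.graph.smul_mem c h1, fun j => by
          rw [inner_smul_right, inner_smul_right, h2]; ring⟩
    have hclosed : IsClosed {p : E × E | ∀ j, inner ℂ (g j) p.2 = lam j * inner ℂ (g j) p.1} := by
      rw [Set.ofPred_forall]
      refine isClosed_iInter fun j => isClosed_eq ?_ ?_ <;> fun_prop
    intro h
    refine closure_minimal (s := (T.graph : Set (E × E))) ?_ hclosed h
    rintro ⟨x, y⟩ hxy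
    obtain ⟨y', h1, h2⟩ := hmem x (hdom (LinearPMap.mem_domain_of_mem_graph hxy))
    have : y = y' := T.mem_graph_snd_inj hxy h1 rfl
    rw [this]
    exact h2
  · intro h
    have h1 := (g.hasSum_repr ψ).prodMk (g.hasSum_repr φ)
    refine mem_closure_of_tendsto h1 (Eventually.of_forall fun s => ?_)
    refine T.graph.sum_mem fun j _ => ?_
    have := T.graph.smul_mem (g.repr ψ j) (hT j)
    convert this using 1
    rw [Prod.smul_mk, smul_smul, g.repr_apply_apply, g.repr_apply_apply, h j, mul_comm]

omit [CompleteSpace E] in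
theorem HilbertBasis.mem_graph_closure_iff (g : HilbertBasis ι ℂ E) {lam : ι → ℝ}
    {T : E →ₗ.[ℂ] E} (hdom : T.domain ≤ Submodule.span ℂ (Set.range g))
    (hT : ∀ j, (g j, (lam j : ℂ) • g j) ∈ T.graph) (ψ φ : E) :
    (ψ, φ) ∈ T.closure.graph ↔ ∀ j, inner ℂ (g j) φ = lam j * inner ℂ (g j) ψ := by
  -- `LinearPMap.closure` leaves a non-closable operator unchanged, so closability has to be
  -- established; it holds because the coordinate relation forces `φ = 0` when `ψ = 0`.
  have hclosable : T.IsClosable := by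
    refine ⟨T.graph.topologicalClosure.toLinearPMap, (Submodule.toLinearPMap_graph_eq _ ?_).symm⟩
    rintro ⟨x, y⟩ hxy rfl
    exact g.ext_inner fun j => by
      simpa using (g.topologicalClosure_graph hdom hT _ _).1 hxy j
  rw [← hclosable.graph_closure_eq_closure_graph, g.topologicalClosure_graph hdom hT]

theorem HilbertBasis.isExpGroup_diagonal (g : HilbertBasis ι ℂ E) {lam : ι → ℝ}
    {T : E →ₗ.[ℂ] E} (hdom : T.domain ≤ Submodule.span ℂ (Set.range g))
    (hT : ∀ j, (g j, (lam j : ℂ) • g j) ∈ T.graph) :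
    IsExpGroup T.closure fun t => g.diagonal fun j => t * lam j where
  map_zero := g.unitary_ext fun j => by simp
  map_add s t := g.unitary_ext fun j => by
    simp [smul_smul, ← Complex.exp_add]; ring_nf
  continuous := g.continuous_diagonal lam
  generator ψ φ := by
    rw [g.mem_graph_closure_iff hdom hT]
    refine ⟨g.hasDerivAt_diagonal, fun h j => ?_⟩
    -- Differentiability of the orbit implies that of each coordinate, which is an explicit phase;
    -- comparing the derivatives gives the coordinate relation.
    have h1 := ((innerSL ℂ (g j)).restrictScalars ℝ).hasFDerivAt.comp_hasDerivAt (0 : ℝ) h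
    have h2 : HasDerivAt (fun t : ℝ => Complex.exp (Complex.I * ↑(t * lam j)) * inner ℂ (g j) ψ)
        (Complex.I * lam j * inner ℂ (g j) ψ) 0 := by
      have h3 : HasDerivAt (fun s : ℝ => Complex.I * ↑(s * lam j)) (Complex.I * lam j) 0 := by
        have h2 : HasDerivAt (fun s : ℝ => s * lam j) (lam j) 0 := by
          simpa using (hasDerivAt_id (0 : ℝ)).mul_const (lam j)
        exact h2.ofReal_comp.const_mul _
      simpa using (h3.cexp).mul_const (inner ℂ (g j) ψ)
    have h4 := h1.unique (by simpa [Function.comp_def, g.inner_diagonal] using h2)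
    simp only [ContinuousLinearMap.coe_restrictScalars', innerSL_apply_apply, inner_smul_right] at h4
    rw [mul_assoc] at h4
    exact mul_left_cancel₀ Complex.I_ne_zero h4

omit [CompleteSpace E] in
-- The vector `exp (-i t c) V t ψ` has derivative zero. With a basis of eigenvectors this settles
-- uniqueness of the exponential group without Stone's theorem.
theorem JaynesCummings.IsExpGroup.apply_eq {A : E →ₗ.[ℂ] E} {V : ℝ → (E ≃ₗᵢ[ℂ] E)}
    (hV : IsExpGroup A V) {ψ : E} {c : ℝ} (h : (ψ, (c : ℂ) • ψ) ∈ A.graph) (t : ℝ) :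
    V t ψ = Complex.exp (Complex.I * ↑(t * c)) • ψ := by
  have h0 := (hV.generator _ _).1 h
  have hs : ∀ s : ℝ, HasDerivAt (fun t => V t ψ) (Complex.I • (c : ℂ) • V s ψ) s := by
    intro s
    have h1 : HasDerivAt (fun t => V (t - s) ψ) (Complex.I • (c : ℂ) • ψ) s := by
      have := HasDerivAt.scomp (g₁ := fun t => V t ψ) (h := fun t : ℝ => t - s) s
        (by simpa using h0) ((hasDerivAt_id s).sub_const s)
      simpa [Function.comp_def] using this
    have h2 := (((V s).toContinuousLinearEquiv : E →L[ℂ] E).restrictScalars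
      ℝ).hasFDerivAt.comp_hasDerivAt s h1
    have h3 : ∀ t, V s (V (t - s) ψ) = V t ψ := fun t => by
      change (V s * V (t - s)) ψ = _
      rw [← hV.map_add, add_sub_cancel]
    simpa [Function.comp_def, h3] using h2
  have hconst : ∀ s : ℝ, HasDerivAt (fun t : ℝ => Complex.exp (-(Complex.I * ↑(t * c))) • V t ψ) 0 s := by
    intro s
    have h1 : HasDerivAt (fun s : ℝ => -(Complex.I * ↑(s * c))) (-(Complex.I * c)) s := by
      have h2 : HasDerivAt (fun s : ℝ => s * c) c s := by
        simpa using (hasDerivAt_id s).mul_const c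
      exact (h2.ofReal_comp.const_mul _).neg
    refine (h1.cexp.smul (hs s)).congr_deriv ?_
    rw [smul_smul, smul_smul, ← add_smul]
    ring_nf
    exact zero_smul _ _
  have := is_const_of_deriv_eq_zero (fun s => (hconst s).differentiableAt)
    (fun s => (hconst s).deriv) t 0
  simp only [zero_mul, Complex.ofReal_zero, mul_zero, neg_zero, Complex.exp_zero, one_smul,
    hV.map_zero, LinearIsometryEquiv.coe_one, id_eq] at this
  conv_rhs => rw [← this]
  rw [smul_smul, ← Complex.exp_add, add_neg_cancel, Complex.exp_zero, one_smul]

theorem HilbertBasis.eq_diagonal_of_isExpGroup (g : HilbertBasis ι ℂ E) {lam : ι → ℝ}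
    {T : E →ₗ.[ℂ] E} (hT : ∀ j, (g j, (lam j : ℂ) • g j) ∈ T.graph) {V : ℝ → (E ≃ₗᵢ[ℂ] E)}
    (hV : IsExpGroup T.closure V) (t : ℝ) : V t = g.diagonal fun j => t * lam j :=
  g.unitary_ext fun j => by
    rw [hV.apply_eq (LinearPMap.le_graph_of_le T.le_closure (hT j)), g.diagonal_apply_self]

end Diagonal

noncomputable section
namespace JaynesCummings

/-! ### The number basis of the joint space and the Hamiltonians in it. -/

section Basis

variable {K : Type*} [NormedAddCommGroup K] [InnerProductSpace ℂ K]

/-- The vector `|i⟩` of the atom. -/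
abbrev atomKet (i : Fin 2) : Atom := EuclideanSpace.single i 1

theorem inner_atomKet (i j : Fin 2) : inner ℂ (atomKet i) (atomKet j) = if i = j then (1 : ℂ) else 0 := by
  simp [atomKet, EuclideanSpace.inner_single_left, PiLp.single_apply]

theorem atom_eq_sum (v : Atom) : v = ∑ i, v i • atomKet i := by
  ext j; fin_cases j <;> simp [atomKet]

/-- The joint state space is isometric to the direct sum of two copies of the mode space. -/
def jointIsometry (K : Type*) [NormedAddCommGroup K] [InnerProductSpace ℂ K] :
    PiLp 2 (fun _ : Fin 2 => K) →ₗᵢ[ℂ] Atom ⊗[ℂ] K :=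
  LinearMap.isometryOfInner
    { toFun := fun x => ∑ i, atomKet i ⊗ₜ[ℂ] x i
      map_add' := fun x y => by simp [TensorProduct.tmul_add, Finset.sum_add_distrib]
      map_smul' := fun c x => by simp [TensorProduct.tmul_smul] }
    fun x y => by
      simp [sum_inner, inner_sum, PiLp.inner_apply, TensorProduct.inner_tmul,
        -Fin.sum_univ_two]

theorem jointIsometry_apply (x : PiLp 2 (fun _ : Fin 2 => K)) :
    jointIsometry K x = ∑ i, atomKet i ⊗ₜ[ℂ] x i := rfl

theorem jointIsometry_surjective : Function.Surjective (jointIsometry K) := by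
  intro y
  induction y using TensorProduct.induction_on with
  | zero => exact ⟨0, map_zero _⟩
  | tmul v k =>
    refine ⟨WithLp.toLp 2 fun i => v i • k, ?_⟩
    conv_rhs => rw [atom_eq_sum v, TensorProduct.sum_tmul]
    simp [jointIsometry_apply, TensorProduct.smul_tmul]
  | add x y hx hy =>
    obtain ⟨x', rfl⟩ := hx
    obtain ⟨y', rfl⟩ := hy
    exact ⟨x' + y', map_add _ _ _⟩

/-- The tensor product is isometric to a sum of two copies of `K`, so it needs no completion. -/
instance completeSpace_joint [CompleteSpace K] : CompleteSpace (Atom ⊗[ℂ] K) :=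
  ((LinearIsometryEquiv.ofSurjective (jointIsometry K)
    jointIsometry_surjective).toIsometryEquiv.symm).completeSpace

variable [CompleteSpace K]

/-- The Hilbert basis `|i⟩ ⊗ |n⟩` of the joint state space. -/
def jointBasis (b : HilbertBasis ℕ ℂ K) : HilbertBasis (Fin 2 × ℕ) ℂ (Atom ⊗[ℂ] K) :=
  HilbertBasis.mk (v := fun j => atomKet j.1 ⊗ₜ[ℂ] b j.2)
    (by
      rw [orthonormal_iff_ite]
      rintro ⟨i, n⟩ ⟨j, m⟩
      rw [TensorProduct.inner_tmul, inner_atomKet, orthonormal_iff_ite.1 b.orthonormal]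
      by_cases h1 : i = j <;> by_cases h2 : n = m <;> simp [h1, h2])
    (by
      set S := Submodule.span ℂ (Set.range fun j : Fin 2 × ℕ => atomKet j.1 ⊗ₜ[ℂ] b j.2)
      have hk : ∀ (i : Fin 2) (k : K), atomKet i ⊗ₜ[ℂ] k ∈ S.topologicalClosure := by
        intro i k
        have hcont : Continuous fun k : K => atomKet i ⊗ₜ[ℂ] k :=
          (TensorProduct.mkL ℂ Atom K (atomKet i)).continuous
        have hmaps : Set.MapsTo (fun k : K => atomKet i ⊗ₜ[ℂ] k)
            (Submodule.span ℂ (Set.range b) : Set K) S := by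
          intro k hk
          induction hk using Submodule.span_induction with
          | mem x hx => obtain ⟨n, rfl⟩ := hx; exact Submodule.subset_span ⟨(i, n), rfl⟩
          | zero => simp
          | add x y _ _ hx hy =>
            simp only [TensorProduct.tmul_add]; exact S.add_mem hx hy
          | smul c x _ hx =>
            simp only [TensorProduct.tmul_smul]; exact S.smul_mem c hx
        exact hmaps.closure hcont (b.dense_span_range k)
      intro y _
      obtain ⟨x, rfl⟩ := jointIsometry_surjective y
      rw [jointIsometry_apply]
      exact Submodule.sum_mem _ fun i _ => hk i _)

theorem jointBasis_apply (b : HilbertBasis ℕ ℂ K) (j : Fin 2 × ℕ) :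
    jointBasis b j = atomKet j.1 ⊗ₜ[ℂ] b j.2 := by
  simp [jointBasis]

/-- The vectors `|i⟩ ⊗ |n⟩` among the finite states. -/
def finiteKet (j : Fin 2 × ℕ) : FiniteStates := atomKet j.1 ⊗ₜ[ℂ] Finsupp.single j.2 1

theorem inclusion_finiteKet (b : HilbertBasis ℕ ℂ K) (j : Fin 2 × ℕ) :
    inclusion b (finiteKet j) = jointBasis b j := by
  simp [inclusion, finiteKet, jointBasis_apply]

theorem domain_onFiniteStates (b : HilbertBasis ℕ ℂ K) (T : FiniteStates →ₗ[ℂ] FiniteStates) :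
    (onFiniteStates b T).domain = Submodule.span ℂ (Set.range (jointBasis b)) := by
  have htop : (⊤ : Submodule ℂ FiniteStates) = Submodule.span ℂ (Set.range finiteKet) := by
    refine le_antisymm ?_ le_top
    intro x _
    induction x using TensorProduct.induction_on with
    | zero => exact Submodule.zero_mem _
    | tmul v k =>
      rw [atom_eq_sum v, TensorProduct.sum_tmul]
      refine Submodule.sum_mem _ fun i _ => ?_
      rw [← TensorProduct.smul_tmul']
      refine Submodule.smul_mem _ _ ?_
      clear * -
      induction k using Finsupp.induction_linear with
      | zero => simp
      | add f g hf hg => rw [TensorProduct.tmul_add]; exact Submodule.add_mem _ hf hg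
      | single n c =>
        rw [show Finsupp.single n c = c • Finsupp.single n (1 : ℂ) by simp,
          TensorProduct.tmul_smul]
        exact Submodule.smul_mem _ _ (Submodule.subset_span ⟨(i, n), rfl⟩)
    | add x y hx hy => exact Submodule.add_mem _ (hx trivial) (hy trivial)
  change LinearMap.range (inclusion b) = _
  rw [← Submodule.map_top, htop, Submodule.map_span, ← Set.range_comp]
  congr 2
  ext1 j
  exact inclusion_finiteKet b j

omit [CompleteSpace K] in
theorem inclusion_mem_graph (b : HilbertBasis ℕ ℂ K) (T : FiniteStates →ₗ[ℂ] FiniteStates)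
    (x : FiniteStates) : (inclusion b x, inclusion b (T x)) ∈ (onFiniteStates b T).graph := by
  rw [LinearPMap.mem_graph_iff]
  refine ⟨⟨inclusion b x, x, rfl⟩, rfl, ?_⟩
  change inclusion b (T ((LinearEquiv.ofInjective (inclusion b) (inclusion_injective b)).symm _)) = _
  congr 2
  exact (LinearEquiv.ofInjective (inclusion b) (inclusion_injective b)).symm_apply_apply x

theorem tensorOp_finiteKet (σ : Matrix (Fin 2) (Fin 2) ℂ)
    (B : FiniteNumberStates →ₗ[ℂ] FiniteNumberStates) (j : Fin 2 × ℕ) :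
    tensorOp σ B (finiteKet j) =
      ∑ i, σ i j.1 • atomKet i ⊗ₜ[ℂ] B (Finsupp.single j.2 1) := by
  have : Matrix.toEuclideanLin σ (atomKet j.1) = ∑ i, σ i j.1 • atomKet i := by
    conv_lhs => rw [atom_eq_sum (Matrix.toEuclideanLin σ (atomKet j.1))]
    refine Finset.sum_congr rfl fun i _ => ?_
    congr 1
    simp [atomKet, Matrix.toLpLin_apply]
  rw [tensorOp, finiteKet, TensorProduct.map_tmul, this, TensorProduct.sum_tmul]
  rfl

theorem preJC1_up (n : ℕ) : preJC1 (finiteKet (0, n)) = (1 / 2 : ℂ) • finiteKet (0, n) := by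
  simp only [preJC1, LinearMap.smul_apply, tensorOp_finiteKet]
  simp [pauli3, finiteKet]

theorem preJC1_down (n : ℕ) : preJC1 (finiteKet (1, n)) = (-1 / 2 : ℂ) • finiteKet (1, n) := by
  simp only [preJC1, LinearMap.smul_apply, tensorOp_finiteKet]
  simp [pauli3, finiteKet, neg_div]

/-- The matrices `σ₊` and `σ₋` are twice the elementary raising and lowering matrices, which cancels
the prefactor `1 / 2`. -/
theorem preJC2_up (n : ℕ) :
    preJC2 (finiteKet (0, n)) = ((Real.sqrt (n + 1) : ℝ) : ℂ) • finiteKet (1, n + 1) := by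
  have h : Finsupp.single (n + 1) ((Real.sqrt (n + 1) : ℝ) : ℂ) =
      ((Real.sqrt (n + 1) : ℝ) : ℂ) • Finsupp.single (n + 1) (1 : ℂ) := by simp
  simp only [preJC2, LinearMap.smul_apply, LinearMap.add_apply, tensorOp_finiteKet]
  simp [pauliPlus, pauliMinus, pauli1, pauli2, finiteKet, creation]
  rw [h, TensorProduct.tmul_smul, smul_smul, one_add_one_eq_two, inv_mul_cancel₀ two_ne_zero, one_smul]
  rfl

theorem preJC2_vacuum : preJC2 (finiteKet (1, 0)) = 0 := by
  simp only [preJC2, LinearMap.smul_apply, LinearMap.add_apply, tensorOp_finiteKet]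
  simp [pauliPlus, pauliMinus, pauli1, pauli2, annihilation]

theorem preJC2_down (n : ℕ) :
    preJC2 (finiteKet (1, n + 1)) = ((Real.sqrt (n + 1) : ℝ) : ℂ) • finiteKet (0, n) := by
  have h : Finsupp.single n ((Real.sqrt (n + 1) : ℝ) : ℂ) =
      ((Real.sqrt (n + 1) : ℝ) : ℂ) • Finsupp.single n (1 : ℂ) := by simp
  simp only [preJC2, LinearMap.smul_apply, LinearMap.add_apply, tensorOp_finiteKet]
  simp [pauliPlus, pauliMinus, pauli1, pauli2, finiteKet, annihilation]
  rw [h, TensorProduct.tmul_smul, smul_smul, one_add_one_eq_two, inv_mul_cancel₀ two_ne_zero, one_smul]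
  rfl

theorem number_single (n : ℕ) : number (Finsupp.single n 1) = (n : ℂ) • Finsupp.single n 1 := by
  rcases n with _ | n
  · simp [number, annihilation]
  · simp only [number, LinearMap.comp_apply, annihilation, creation,
      Finsupp.linearCombination_single, one_smul, Nat.add_sub_cancel, Finsupp.smul_single,
      smul_eq_mul, mul_one]
    congr 1
    rw [← Complex.ofReal_mul, Nat.cast_succ, Real.mul_self_sqrt (by positivity)]
    simp

/-- The eigenvalue of the charge at the vector `|i⟩ ⊗ |n⟩`. -/
def chargeValue : Fin 2 × ℕ → ℕ
  | (0, n) => n + 1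
  | (1, n) => n

theorem preCharge_finiteKet (j : Fin 2 × ℕ) :
    preCharge (finiteKet j) = (chargeValue j : ℂ) • finiteKet j := by
  obtain ⟨i, n⟩ := j
  simp only [preCharge, LinearMap.add_apply, tensorOp_finiteKet]
  fin_cases i
  · simp [number_single, pauli3, finiteKet, chargeValue, Matrix.one_apply, add_smul,
      TensorProduct.tmul_smul, -Finsupp.smul_single,  one_add_one_eq_two]
    abel
  · simp [number_single, pauli3, finiteKet, chargeValue, Matrix.one_apply,
      TensorProduct.tmul_smul, -Finsupp.smul_single]

end Basis


/-! ### Quaternions as SU(2) blocks and the group of block unitaries. -/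

open Quaternion ComplexConjugate

/-- The upper left entry of the matrix of a quaternion. -/
def alpha (q : ℍ[ℝ]) : ℂ := q.re + q.imK * Complex.I

/-- The lower left entry of the matrix of a quaternion. -/
def beta (q : ℍ[ℝ]) : ℂ := q.imJ + q.imI * Complex.I

/-- Sending `i, j, k` to `iσ₁, -iσ₂, iσ₃` turns a quaternion into the matrix with columns `(α, β)`
and `(-β̄, ᾱ)`; products go to matrix products. -/
theorem alpha_mul (q p : ℍ[ℝ]) : alpha (q * p) = alpha p * alpha q - beta p * conj (beta q) := by
  apply Complex.ext <;> simp [alpha, beta] <;> ring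

theorem beta_mul (q p : ℍ[ℝ]) : beta (q * p) = alpha p * beta q + beta p * conj (alpha q) := by
  apply Complex.ext <;> simp [alpha, beta] <;> ring

theorem alpha_star (q : ℍ[ℝ]) : alpha (star q) = conj (alpha q) := by
  apply Complex.ext <;> simp [alpha]

theorem beta_star (q : ℍ[ℝ]) : beta (star q) = -beta q := by
  apply Complex.ext <;> simp [beta]

theorem continuous_alpha : Continuous alpha := by
  unfold alpha
  have := continuous_re
  have := continuous_imK
  fun_prop

theorem continuous_beta : Continuous beta := by
  unfold beta
  have := continuous_imI
  have := continuous_imJ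
  fun_prop

theorem exists_alpha_beta (a c : ℂ) : ∃ q : ℍ[ℝ], alpha q = a ∧ beta q = c :=
  ⟨⟨a.re, c.im, c.re, a.im⟩, Complex.re_add_im a, Complex.re_add_im c⟩

theorem alpha_beta_normSq (q : ℍ[ℝ]) :
    conj (alpha q) * alpha q + conj (beta q) * beta q = (‖q‖ ^ 2 : ℝ) := by
  rw [sq, ← normSq_eq_norm_mul_self, normSq_def']
  apply Complex.ext <;> simp [alpha, beta, sq] <;> ring

@[elab_as_elim]
-- The cases follow the blocks: the vacuum alone, and the two vectors of the block `n`, whose charge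
-- is `n + 1`.
theorem ket_induction {P : Fin 2 × ℕ → Prop} (vacuum : P (1, 0)) (up : ∀ n, P (0, n))
    (down : ∀ n, P (1, n + 1)) (j : Fin 2 × ℕ) : P j := by
  obtain ⟨i, n⟩ := j
  fin_cases i
  · exact up n
  · cases n with
    | zero => exact vacuum
    | succ n => exact down n

section Blocks

variable {E : Type*} [NormedAddCommGroup E] [InnerProductSpace ℂ E]
  (e : HilbertBasis (Fin 2 × ℕ) ℂ E)

/-- On the span of `|↑⟩ ⊗ |n⟩` and `|↓⟩ ⊗ |n + 1⟩` the unitary `U` acts as the matrix of the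
quaternion `q`. -/
structure ActsAs (U : E ≃ₗᵢ[ℂ] E) (n : ℕ) (q : ℍ[ℝ]) : Prop where
  up : U (e (0, n)) = alpha q • e (0, n) + beta q • e (1, n + 1)
  down : U (e (1, n + 1)) = -conj (beta q) • e (0, n) + conj (alpha q) • e (1, n + 1)

variable {e}

theorem ActsAs.one (n : ℕ) : ActsAs e 1 n 1 := by
  constructor <;> simp [alpha, beta]

theorem ActsAs.mul {U V : E ≃ₗᵢ[ℂ] E} {n : ℕ} {q p : ℍ[ℝ]} (hU : ActsAs e U n q)
    (hV : ActsAs e V n p) : ActsAs e (U * V) n (q * p) := by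
  constructor
  · change U (V _) = _
    rw [hV.up, map_add, map_smul, map_smul, hU.up, hU.down, alpha_mul, beta_mul]
    module
  · change U (V _) = _
    rw [hV.down, map_add, map_smul, map_smul, hU.up, hU.down, alpha_mul, beta_mul]
    simp only [map_add, map_sub, map_mul, Complex.conj_conj]
    module

theorem ActsAs.norm_eq_one {U : E ≃ₗᵢ[ℂ] E} {n : ℕ} {q : ℍ[ℝ]} (hU : ActsAs e U n q) :
    ‖q‖ = 1 := by
  have h := U.inner_map_map (e (0, n)) (e (0, n))
  rw [hU.up, e.inner_self_eq_one] at h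
  have h01 : inner ℂ (e (0, n)) (e (1, n + 1)) = 0 := e.inner_eq_zero_of_ne (by simp)
  have h10 : inner ℂ (e (1, n + 1)) (e (0, n)) = 0 := e.inner_eq_zero_of_ne (by simp)
  simp only [inner_add_left, inner_add_right, inner_smul_left, inner_smul_right,
    e.inner_self_eq_one, h01, h10, mul_zero, add_zero, zero_add, mul_one] at h
  rw [mul_comm, mul_comm (beta q), alpha_beta_normSq] at h
  have h2 : ‖q‖ ^ 2 = 1 := by exact_mod_cast h
  nlinarith [norm_nonneg q]

theorem ActsAs.inv {U : E ≃ₗᵢ[ℂ] E} {n : ℕ} {q : ℍ[ℝ]} (hU : ActsAs e U n q) :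
    ActsAs e U⁻¹ n (star q) := by
  have h := alpha_beta_normSq q
  rw [hU.norm_eq_one, one_pow, Complex.ofReal_one] at h
  constructor
  · refine U.injective ((U.apply_symm_apply _).trans ?_)
    rw [map_add, map_smul, map_smul, hU.up, hU.down, alpha_star, beta_star]
    calc e (0, n) = (conj (alpha q) * alpha q + conj (beta q) * beta q) • e (0, n) := by
          rw [h, one_smul]
      _ = _ := by module
  · refine U.injective ((U.apply_symm_apply _).trans ?_)
    rw [map_add, map_smul, map_smul, hU.up, hU.down, alpha_star, beta_star]
    simp only [map_neg, Complex.conj_conj]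
    calc e (1, n + 1) = (conj (alpha q) * alpha q + conj (beta q) * beta q) • e (1, n + 1) := by
          rw [h, one_smul]
      _ = _ := by module

/-- Reading the quaternion off from matrix elements replaces the existential by equations that are
strongly continuous in `U`, as closedness of `blockGroup` requires. -/
theorem actsAs_iff_inner {U : E ≃ₗᵢ[ℂ] E} {n : ℕ} :
    (∃ q, ActsAs e U n q) ↔
      U (e (0, n)) = inner ℂ (e (0, n)) (U (e (0, n))) • e (0, n) +
        inner ℂ (e (1, n + 1)) (U (e (0, n))) • e (1, n + 1) ∧
      U (e (1, n + 1)) = -conj (inner ℂ (e (1, n + 1)) (U (e (0, n)))) • e (0, n) +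
        conj (inner ℂ (e (0, n)) (U (e (0, n)))) • e (1, n + 1) := by
  constructor
  · rintro ⟨q, hq⟩
    have h01 : inner ℂ (e (0, n)) (e (1, n + 1)) = 0 := e.inner_eq_zero_of_ne (by simp)
    have h10 : inner ℂ (e (1, n + 1)) (e (0, n)) = 0 := e.inner_eq_zero_of_ne (by simp)
    have ha : inner ℂ (e (0, n)) (U (e (0, n))) = alpha q := by
      rw [hq.up, inner_add_right, inner_smul_right, inner_smul_right, h01, e.inner_self_eq_one]
      simp
    have hb : inner ℂ (e (1, n + 1)) (U (e (0, n))) = beta q := by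
      rw [hq.up, inner_add_right, inner_smul_right, inner_smul_right, h10, e.inner_self_eq_one]
      simp
    rw [ha, hb]
    exact ⟨hq.up, hq.down⟩
  · rintro ⟨h1, h2⟩
    obtain ⟨q, ha, hb⟩ := exists_alpha_beta (inner ℂ (e (0, n)) (U (e (0, n))))
      (inner ℂ (e (1, n + 1)) (U (e (0, n))))
    exact ⟨q, by rw [ha, hb]; exact h1, by rw [ha, hb]; exact h2⟩

variable (e)

/-- The unitaries that preserve all blocks, with determinant one except for the vacuum block. -/
def blockGroup : Subgroup (E ≃ₗᵢ[ℂ] E) where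
  carrier := {U | (∃ z : ℂ, U (e (1, 0)) = z • e (1, 0)) ∧ ∀ n, ∃ q, ActsAs e U n q}
  one_mem' := ⟨⟨1, by simp⟩, fun n => ⟨1, ActsAs.one n⟩⟩
  mul_mem' := by
    rintro U V ⟨⟨z, hz⟩, hU⟩ ⟨⟨w, hw⟩, hV⟩
    refine ⟨⟨w * z, ?_⟩, fun n => ?_⟩
    · change U (V _) = _
      rw [hw, map_smul, hz, smul_smul]
    · obtain ⟨q, hq⟩ := hU n
      obtain ⟨p, hp⟩ := hV n
      exact ⟨_, hq.mul hp⟩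
  inv_mem' := by
    rintro U ⟨⟨z, hz⟩, hU⟩
    refine ⟨⟨z⁻¹, ?_⟩, fun n => ?_⟩
    · refine U.injective ((U.apply_symm_apply _).trans ?_)
      have hz0 : z ≠ 0 := by
        rintro rfl
        rw [zero_smul] at hz
        have := e.orthonormal.1 (1, 0)
        rw [← U.norm_map, hz, norm_zero] at this
        exact zero_ne_one this
      rw [map_smul, hz, smul_smul, inv_mul_cancel₀ hz0, one_smul]
    · obtain ⟨q, hq⟩ := hU n
      exact ⟨_, hq.inv⟩

theorem isStronglyClosed_blockGroup : IsStronglyClosed (blockGroup e : Set (E ≃ₗᵢ[ℂ] E)) := by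
  let _ := strongTopology E
  have hc : ∀ ψ : E, Continuous fun U : E ≃ₗᵢ[ℂ] E => U ψ := fun ψ =>
    (continuous_apply ψ).comp continuous_induced_dom
  have heq : (blockGroup e : Set (E ≃ₗᵢ[ℂ] E)) =
      {U | U (e (1, 0)) = inner ℂ (e (1, 0)) (U (e (1, 0))) • e (1, 0)} ∩
      ⋂ n : ℕ, {U | U (e (0, n)) = inner ℂ (e (0, n)) (U (e (0, n))) • e (0, n) +
          inner ℂ (e (1, n + 1)) (U (e (0, n))) • e (1, n + 1)} ∩
        {U | U (e (1, n + 1)) = -conj (inner ℂ (e (1, n + 1)) (U (e (0, n)))) • e (0, n) +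
          conj (inner ℂ (e (0, n)) (U (e (0, n)))) • e (1, n + 1)} := by
    ext U
    change ((∃ z : ℂ, U (e (1, 0)) = z • e (1, 0)) ∧ ∀ n, ∃ q, ActsAs e U n q) ↔ _
    simp only [actsAs_iff_inner, Set.mem_inter_iff, Set.mem_iInter]
    refine and_congr ⟨?_, fun h => ⟨_, h⟩⟩ Iff.rfl
    rintro ⟨z, hz⟩
    change U (e (1, 0)) = inner ℂ (e (1, 0)) (U (e (1, 0))) • e (1, 0)
    rw [hz, inner_smul_right, e.inner_self_eq_one, mul_one]
  unfold IsStronglyClosed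
  rw [heq]
  have hi : ∀ j k, Continuous fun U : E ≃ₗᵢ[ℂ] E => inner ℂ (e j) (U (e k)) := fun j k =>
    continuous_const.inner (hc _)
  refine IsClosed.inter (isClosed_eq (hc _) ((hi _ _).smul continuous_const))
    (isClosed_iInter fun n => IsClosed.inter (isClosed_eq (hc _) ?_) (isClosed_eq (hc _) ?_))
  · exact ((hi _ _).smul continuous_const).add ((hi _ _).smul continuous_const)
  · exact ((Complex.continuous_conj.comp (hi _ _)).neg.smul continuous_const).add
      ((Complex.continuous_conj.comp (hi _ _)).smul continuous_const)

end Blocks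

open Filter Topology

/-! ### The two flows and the unitaries they generate. -/

section Control

variable {E : Type*} [NormedAddCommGroup E] [InnerProductSpace ℂ E]
  (e : HilbertBasis (Fin 2 × ℕ) ℂ E)

/-- The eigenvalues of `(σ₃ ⊗ 1) / 2`. -/
def spinValue : Fin 2 × ℕ → ℝ
  | (0, _) => 1 / 2
  | (1, _) => -1 / 2

/-- The eigenvalues of `(σ₊ ⊗ a + σ₋ ⊗ a*) / 2`. -/
def couplingValue : Fin 2 × ℕ → ℝ
  | (0, n) => Real.sqrt (n + 1)
  -- At `n = 0` this is the vacuum eigenvalue `0`.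
  | (1, n) => -Real.sqrt n

/-- The normalization `1 / √2`. -/
def invSqrtTwo : ℂ := ((Real.sqrt 2)⁻¹ : ℝ)

theorem invSqrtTwo_mul_self : invSqrtTwo * invSqrtTwo = 1 / 2 := by
  rw [invSqrtTwo, ← Complex.ofReal_mul, ← mul_inv, Real.mul_self_sqrt (by norm_num)]
  norm_num

/-- The dressed states, which diagonalize the coupling. -/
def dressedKet : Fin 2 × ℕ → E
  | (0, n) => invSqrtTwo • (e (0, n) + e (1, n + 1))
  | (1, 0) => e (1, 0)
  | (1, n + 1) => invSqrtTwo • (e (0, n) - e (1, n + 1))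

theorem ket_up_eq (n : ℕ) :
    e (0, n) = invSqrtTwo • (dressedKet e (0, n) + dressedKet e (1, n + 1)) := by
  simp only [dressedKet, smul_add, smul_sub, smul_smul, invSqrtTwo_mul_self]
  module

theorem ket_down_eq (n : ℕ) :
    e (1, n + 1) = invSqrtTwo • (dressedKet e (0, n) - dressedKet e (1, n + 1)) := by
  simp only [dressedKet, smul_add, smul_sub, smul_smul, invSqrtTwo_mul_self]
  module

theorem orthonormal_dressedKet : Orthonormal ℂ (dressedKet e) := by
  have he := orthonormal_iff_ite.1 e.orthonormal
  have hconj : conj invSqrtTwo = invSqrtTwo := Complex.conj_ofReal _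
  rw [orthonormal_iff_ite]
  intro j k
  induction j using ket_induction <;> induction k using ket_induction <;>
  simp only [dressedKet, inner_smul_left, inner_smul_right, inner_add_left, inner_add_right,
    inner_sub_left, inner_sub_right, he, Prod.mk.injEq, hconj] <;>
  simp
  all_goals
    rename_i n m
    by_cases h : n = m
    · simp [h, mul_add, invSqrtTwo_mul_self]
      try norm_num
    · simp [h]

theorem span_range_dressedKet :
    Submodule.span ℂ (Set.range (dressedKet e)) = Submodule.span ℂ (Set.range e) := by
  have hd : ∀ j, dressedKet e j ∈ Submodule.span ℂ (Set.range (dressedKet e)) := fun j =>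
    Submodule.subset_span ⟨j, rfl⟩
  have hs : ∀ j, e j ∈ Submodule.span ℂ (Set.range e) := fun j => Submodule.subset_span ⟨j, rfl⟩
  apply le_antisymm <;> rw [Submodule.span_le] <;> rintro _ ⟨j, rfl⟩
  · induction j using ket_induction with
    | vacuum => exact hs _
    | up n => exact Submodule.smul_mem _ _ (Submodule.add_mem _ (hs _) (hs _))
    | down n => exact Submodule.smul_mem _ _ (Submodule.sub_mem _ (hs _) (hs _))
  · induction j using ket_induction with
    | vacuum => exact hd (1, 0)
    | up n =>
      rw [SetLike.mem_coe, ket_up_eq]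
      exact Submodule.smul_mem _ _ (Submodule.add_mem _ (hd _) (hd _))
    | down n =>
      rw [SetLike.mem_coe, ket_down_eq]
      exact Submodule.smul_mem _ _ (Submodule.sub_mem _ (hd _) (hd _))

variable [CompleteSpace E]

/-- The Hilbert basis of dressed states. -/
def dressedBasis : HilbertBasis (Fin 2 × ℕ) ℂ E :=
  HilbertBasis.mk (orthonormal_dressedKet e) (by rw [span_range_dressedKet, e.dense_span])

theorem dressedBasis_apply (j : Fin 2 × ℕ) : dressedBasis e j = dressedKet e j := by
  rw [dressedBasis, HilbertBasis.coe_mk]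

/-- The unitary `exp (i t H₁)`. -/
def spinFlow (t : ℝ) : E ≃ₗᵢ[ℂ] E := e.diagonal fun j => t * spinValue j

/-- The unitary `exp (i t H₂)`. -/
def couplingFlow (t : ℝ) : E ≃ₗᵢ[ℂ] E := (dressedBasis e).diagonal fun j => t * couplingValue j

variable {e}

theorem spinFlow_vacuum (t : ℝ) :
    spinFlow e t (e (1, 0)) = Complex.exp (Complex.I * ↑(t * (-1 / 2))) • e (1, 0) := by
  rw [spinFlow, HilbertBasis.diagonal_apply_self]; rfl

theorem couplingFlow_vacuum (t : ℝ) : couplingFlow e t (e (1, 0)) = e (1, 0) := by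
  have h := (dressedBasis e).diagonal_apply_self (fun j => t * couplingValue j) (1, 0)
  have h0 : couplingValue (1, 0) = 0 := by simp [couplingValue]
  rw [h0, dressedBasis_apply] at h
  simp only [mul_zero, Complex.ofReal_zero, Complex.exp_zero, one_smul] at h
  exact h

theorem exp_I_mul_ofReal (x : ℝ) :
    Complex.exp (Complex.I * x) = (Real.cos x : ℂ) + (Real.sin x : ℂ) * Complex.I := by
  rw [mul_comm, Complex.exp_mul_I, Complex.ofReal_cos, Complex.ofReal_sin]

theorem actsAs_spinFlow (t : ℝ) (n : ℕ) :
    ActsAs e (spinFlow e t) n ⟨Real.cos (t / 2), 0, 0, Real.sin (t / 2)⟩ := by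
  constructor
  · rw [spinFlow, HilbertBasis.diagonal_apply_self, exp_I_mul_ofReal]
    simp [alpha, beta, spinValue, div_eq_mul_inv]
  · rw [spinFlow, HilbertBasis.diagonal_apply_self, exp_I_mul_ofReal]
    have h : t * spinValue (1, n + 1) = -(t / 2) := by simp only [spinValue]; ring
    rw [h, Real.cos_neg, Real.sin_neg]
    simp [alpha, beta, -Complex.ofReal_cos, -Complex.ofReal_sin]

theorem actsAs_couplingFlow (t : ℝ) (n : ℕ) :
    ActsAs e (couplingFlow e t) n
      ⟨Real.cos (t * Real.sqrt (n + 1)), Real.sin (t * Real.sqrt (n + 1)), 0, 0⟩ := by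
  have h0 : couplingFlow e t (dressedKet e (0, n)) = _ :=
    (dressedBasis_apply e _) ▸ (dressedBasis e).diagonal_apply_self _ (0, n)
  have h1 : couplingFlow e t (dressedKet e (1, n + 1)) = _ :=
    (dressedBasis_apply e _) ▸ (dressedBasis e).diagonal_apply_self _ (1, n + 1)
  have hv0 : t * couplingValue (0, n) = t * Real.sqrt (n + 1) := rfl
  have hv1 : t * couplingValue (1, n + 1) = -(t * Real.sqrt (n + 1)) := by
    simp [couplingValue]
  rw [hv0, exp_I_mul_ofReal] at h0
  rw [hv1, exp_I_mul_ofReal, Real.cos_neg, Real.sin_neg] at h1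
  have h2 : ∀ x : ℂ, invSqrtTwo * (x * invSqrtTwo) = x / 2 := fun x => by
    rw [mul_left_comm, invSqrtTwo_mul_self]; ring
  constructor
  · conv_lhs => rw [ket_up_eq]
    rw [map_smul, map_add, h0, h1]
    simp only [dressedKet, alpha, beta, smul_add, smul_sub, smul_smul, h2]
    push_cast
    module
  · conv_lhs => rw [ket_down_eq]
    rw [map_smul, map_sub, h0, h1]
    simp only [dressedKet, alpha, beta, smul_add, smul_sub, smul_smul, h2]
    simp only [map_add, map_mul, Complex.conj_ofReal, Complex.conj_I]
    push_cast
    module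

theorem exp_smul_of_norm_eq_one {u : ℍ[ℝ]} (hre : u.re = 0) (hu : ‖u‖ = 1) (x : ℝ) :
    NormedSpace.exp (x • u) = (Real.cos x : ℍ[ℝ]) + Real.sin x • u := by
  have hn : ‖x • u‖ = |x| := by rw [norm_smul, hu, mul_one, Real.norm_eq_abs]
  rw [exp_of_re_eq_zero _ (by simp [hre]), hn, Real.cos_abs, smul_smul]
  congr 2
  rcases eq_or_ne x 0 with rfl | hx
  · simp
  -- The function `sin x / x` is even, so the sign of `x` is immaterial.
  · rcases abs_choice x with h | h <;> rw [h]
    · rw [div_mul_cancel₀ _ hx]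
    · rw [Real.sin_neg, neg_div_neg_eq, div_mul_cancel₀ _ hx]

theorem exp_smul_unitI (x : ℝ) :
    NormedSpace.exp (x • unitI) = (⟨Real.cos x, Real.sin x, 0, 0⟩ : ℍ[ℝ]) := by
  rw [exp_smul_of_norm_eq_one unitI_re norm_unitI]
  ext <;> simp

theorem exp_smul_unitJ (x : ℝ) :
    NormedSpace.exp (x • unitJ) = (⟨Real.cos x, 0, Real.sin x, 0⟩ : ℍ[ℝ]) := by
  rw [exp_smul_of_norm_eq_one unitJ_re norm_unitJ]
  ext <;> simp

/-- Conjugation by `(1 + k) / √2` is a quarter turn about `k`, carrying `i` to `j`. -/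
theorem conj_quaternion {c : ℝ} (hc : c * c = 1 / 2) (x y : ℝ) :
    (⟨c, 0, 0, c⟩ * ⟨x, y, 0, 0⟩ * star ⟨c, 0, 0, c⟩ : ℍ[ℝ]) = ⟨x, 0, y, 0⟩ := by
  have key : ∀ a b : ℍ[ℝ], a.re = c → a.imI = 0 → a.imJ = 0 → a.imK = c → b.re = x → b.imI = y →
      b.imJ = 0 → b.imK = 0 → a * b * star a = ⟨x, 0, y, 0⟩ := by
    intro a b h1 h2 h3 h4 h5 h6 h7 h8
    ext <;> simp only [re_mul, imI_mul, imJ_mul, imK_mul, re_star, imI_star, imJ_star, imK_star,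
      h1, h2, h3, h4, h5, h6, h7, h8]
    · linear_combination 2 * x * hc
    · ring
    · linear_combination 2 * y * hc
    · ring
  exact key _ _ rfl rfl rfl rfl rfl rfl rfl rfl

/-- The spin flow alone turns all blocks at the same speed and moves the vacuum phase. Conjugating
with it gives a second axis with the speeds `√(n + 1)` intact, and the vacuum phases cancel. -/
theorem actsAs_conj_couplingFlow (t : ℝ) (n : ℕ) :
    ActsAs e (spinFlow e (Real.pi / 2) * couplingFlow e t * (spinFlow e (Real.pi / 2))⁻¹) n
      ⟨Real.cos (t * Real.sqrt (n + 1)), 0, Real.sin (t * Real.sqrt (n + 1)), 0⟩ := by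
  have h := ((actsAs_spinFlow (e := e) (Real.pi / 2) n).mul (actsAs_couplingFlow t n)).mul
    (actsAs_spinFlow (e := e) (Real.pi / 2) n).inv
  refine Eq.mpr (congrArg (ActsAs e _ n) ?_) h
  have hc : Real.cos (Real.pi / 2 / 2) = Real.sqrt 2 / 2 := by
    rw [← Real.cos_pi_div_four]; congr 1; ring
  have hs : Real.sin (Real.pi / 2 / 2) = Real.sqrt 2 / 2 := by
    rw [← Real.sin_pi_div_four]; congr 1; ring
  have h2 : Real.sqrt 2 * Real.sqrt 2 = 2 := Real.mul_self_sqrt (by norm_num)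
  rw [hc, hs]
  exact (conj_quaternion (by linear_combination (1 / 4) * h2) _ _).symm

/-- A strongly closed group containing both flows contains all unitaries that fix the vacuum and
act on the other blocks as unit quaternions. -/
theorem mem_of_fixes_vacuum {G : Subgroup (E ≃ₗᵢ[ℂ] E)}
    (hG : IsStronglyClosed (G : Set (E ≃ₗᵢ[ℂ] E))) (hspin : ∀ t, spinFlow e t ∈ G)
    (hcoupling : ∀ t, couplingFlow e t ∈ G) {U : E ≃ₗᵢ[ℂ] E} (hvac : U (e (1, 0)) = e (1, 0))
    (hU : ∀ n, ∃ q, ActsAs e U n q) : U ∈ G := by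
  choose q hq using hU
  have happrox : ∀ N : ℕ, ∃ V ∈ G, ∃ p : Fin (N + 1) → ℍ[ℝ], V (e (1, 0)) = e (1, 0) ∧
      (∀ k : Fin (N + 1), ActsAs e V k (p k)) ∧ ∀ k : Fin (N + 1), dist (p k) (q k) < 1 / ((N : ℝ) + 1) := by
    intro N
    -- Tuples realized on the first `N + 1` blocks by elements of `G` fixing the vacuum. Closedness
    -- of `G` does not directly give closedness of `M`, so the control result is applied to the
    -- closure and yields only an approximation.
    let M : Submonoid (Fin (N + 1) → ℍ[ℝ]) :=
      { carrier := {p | ∃ V ∈ G, V (e (1, 0)) = e (1, 0) ∧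
          ∀ k : Fin (N + 1), ActsAs e V k (p k)}
        one_mem' := ⟨1, G.one_mem, rfl, fun k => ActsAs.one _⟩
        mul_mem' := by
          rintro p p' ⟨V, hV, hV0, hVp⟩ ⟨V', hV', hV0', hVp'⟩
          refine ⟨V * V', G.mul_mem hV hV', ?_, fun k => (hVp k).mul (hVp' k)⟩
          change V (V' _) = _
          rw [hV0', hV0] }
    have hmem : (fun k : Fin (N + 1) => q k) ∈ M.topologicalClosure := by
      refine mem_of_isClosed_of_exp_mem M.isClosed_topologicalClosure
        (r := fun k => Real.sqrt ((k : ℝ) + 1)) (fun k => Real.sqrt_pos.2 (by positivity)) ?_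
        (fun t => M.le_topologicalClosure ?_) (fun t => M.le_topologicalClosure ?_) _
        fun k => (hq k).norm_eq_one
      · intro k l hkl
        have := (Real.sqrt_inj (by positivity) (by positivity)).1 hkl
        exact Fin.ext (by exact_mod_cast add_right_cancel this)
      · refine ⟨couplingFlow e t, hcoupling t, couplingFlow_vacuum t, fun k => ?_⟩
        beta_reduce
        rw [smul_smul, exp_smul_unitI]
        exact actsAs_couplingFlow t k
      · refine ⟨_, G.mul_mem (G.mul_mem (hspin (Real.pi / 2)) (hcoupling t))
          (G.inv_mem (hspin (Real.pi / 2))), ?_, fun k => ?_⟩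
        · change spinFlow e _ (couplingFlow e t ((spinFlow e (Real.pi / 2)).symm _)) = _
          have h1 : (spinFlow e (Real.pi / 2)).symm (e (1, 0)) =
              (Complex.exp (Complex.I * ↑(Real.pi / 2 * (-1 / 2))))⁻¹ • e (1, 0) := by
            rw [LinearIsometryEquiv.symm_apply_eq, map_smul, spinFlow_vacuum, smul_smul,
              inv_mul_cancel₀ (Complex.exp_ne_zero _), one_smul]
          rw [h1, map_smul, map_smul, couplingFlow_vacuum, spinFlow_vacuum, smul_smul,
            inv_mul_cancel₀ (Complex.exp_ne_zero _), one_smul]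
        · beta_reduce
          rw [smul_smul, exp_smul_unitJ]
          exact actsAs_conj_couplingFlow t k
    obtain ⟨p, ⟨V, hV, hV0, hVp⟩, hd⟩ := Metric.mem_closure_iff.1 hmem (1 / ((N : ℝ) + 1))
      (by positivity)
    refine ⟨V, hV, p, hV0, hVp, fun k => ?_⟩
    rw [dist_comm]
    exact (dist_le_pi_dist (fun k : Fin (N + 1) => q k) p k).trans_lt hd
  choose V hV p hV0 hVp hdist using happrox
  -- The default `0` occurs only for `N < n` and does not affect the limit.
  have hlim : ∀ n, Tendsto (fun N => if h : n < N + 1 then p N ⟨n, h⟩ else 0) atTop (𝓝 (q n)) := by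
    intro n
    rw [tendsto_iff_dist_tendsto_zero]
    refine squeeze_zero' (Eventually.of_forall fun _ => dist_nonneg) ?_
      tendsto_one_div_add_atTop_nhds_zero_nat
    filter_upwards [eventually_ge_atTop n] with N hN
    rw [dif_pos (Nat.lt_succ_of_le hN)]
    exact (hdist N ⟨n, Nat.lt_succ_of_le hN⟩).le
  -- Each basis vector is the vacuum or lies in a single block, which is under control for all large
  -- `N`.
  have hbasis : ∀ j, Tendsto (fun N => V N (e j)) atTop (𝓝 (U (e j))) := by
    intro j
    induction j using ket_induction with
    | vacuum => simp only [hV0, hvac]; exact tendsto_const_nhds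
    | up n =>
      rw [(hq n).up]
      refine ((((continuous_alpha.tendsto _).comp (hlim n)).smul_const _).add
        (((continuous_beta.tendsto _).comp (hlim n)).smul_const _)).congr' ?_
      filter_upwards [eventually_ge_atTop n] with N hN
      simp only [Function.comp_apply, dif_pos (Nat.lt_succ_of_le hN)]
      exact (hVp N ⟨n, Nat.lt_succ_of_le hN⟩).up.symm
    | down n =>
      rw [(hq n).down]
      refine ((((Complex.continuous_conj.comp continuous_beta).neg.tendsto _).comp
        (hlim n)).smul_const _).add ((((Complex.continuous_conj.comp continuous_alpha).tendsto
        _).comp (hlim n)).smul_const _) |>.congr' ?_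
      filter_upwards [eventually_ge_atTop n] with N hN
      simp only [Function.comp_apply, dif_pos (Nat.lt_succ_of_le hN)]
      exact (hVp N ⟨n, Nat.lt_succ_of_le hN⟩).down.symm
  let _ := strongTopology E
  have hstrong : Tendsto V atTop (𝓝 U) := by
    rw [nhds_induced, tendsto_comap_iff, tendsto_pi_nhds]
    exact fun ψ => e.tendsto_apply_of_forall hbasis ψ
  exact IsClosed.mem_of_tendsto hG hstrong (Eventually.of_forall hV)

theorem blockGroup_le {G : Subgroup (E ≃ₗᵢ[ℂ] E)}
    (hG : IsStronglyClosed (G : Set (E ≃ₗᵢ[ℂ] E))) (hspin : ∀ t, spinFlow e t ∈ G)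
    (hcoupling : ∀ t, couplingFlow e t ∈ G) : blockGroup e ≤ G := by
  rintro U ⟨⟨z, hz⟩, hU⟩
  have hz1 : ‖z‖ = 1 := by
    have := congrArg norm hz
    rwa [U.norm_map, norm_smul, e.orthonormal.1, mul_one, eq_comm] at this
  -- The vacuum eigenvalue of the spin is `-1 / 2`, so time `2 arg z` cancels the phase `z`.
  have hphase : Complex.exp (Complex.I * ↑(2 * z.arg * (-1 / 2))) * z = 1 := by
    have h := Complex.norm_mul_exp_arg_mul_I z
    rw [hz1, Complex.ofReal_one, one_mul] at h
    nth_rewrite 2 [← h]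
    rw [← Complex.exp_add, ← Complex.exp_zero]
    congr 1
    push_cast
    ring
  have hmem : spinFlow e (2 * z.arg) * U ∈ G := by
    refine mem_of_fixes_vacuum hG hspin hcoupling ?_ fun n => ?_
    · change spinFlow e _ (U _) = _
      rw [hz, map_smul, spinFlow_vacuum, smul_smul, mul_comm, hphase, one_smul]
    · obtain ⟨q, hq⟩ := hU n
      exact ⟨_, (actsAs_spinFlow _ n).mul hq⟩
  exact (G.mul_mem_cancel_left (hspin _)).1 hmem

theorem spinFlow_mem_blockGroup (t : ℝ) : spinFlow e t ∈ blockGroup e :=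
  ⟨⟨_, spinFlow_vacuum t⟩, fun n => ⟨_, actsAs_spinFlow t n⟩⟩

theorem couplingFlow_mem_blockGroup (t : ℝ) : couplingFlow e t ∈ blockGroup e :=
  ⟨⟨1, by rw [couplingFlow_vacuum, one_smul]⟩, fun n => ⟨_, actsAs_couplingFlow t n⟩⟩

end Control

theorem det_eq_of_basis_fin_two {M : Type*} [AddCommGroup M] [Module ℂ M]
    (B : Module.Basis (Fin 2) ℂ M) (f : M →ₗ[ℂ] M) {a b c d : ℂ}
    (h0 : f (B 0) = a • B 0 + c • B 1) (h1 : f (B 1) = b • B 0 + d • B 1) :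
    LinearMap.det f = a * d - b * c := by
  rw [← LinearMap.det_toMatrix B, Matrix.det_fin_two]
  simp [LinearMap.toMatrix_apply, h0, h1]

/-! ### Charge eigenspaces, block determinants and the commutant. -/

section Charge

variable {E : Type*} [NormedAddCommGroup E] [InnerProductSpace ℂ E]
  {e : HilbertBasis (Fin 2 × ℕ) ℂ E} {X : E →ₗ.[ℂ] E}

theorem eq_combination_of_inner_eq_zero {n : ℕ} {ψ : E}
    (h : ∀ j, chargeValue j ≠ n + 1 → inner ℂ (e j) ψ = 0) :
    ψ = inner ℂ (e (0, n)) ψ • e (0, n) + inner ℂ (e (1, n + 1)) ψ • e (1, n + 1) := by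
  have he := orthonormal_iff_ite.1 e.orthonormal
  refine e.ext_inner fun j => ?_
  simp only [inner_add_right, inner_smul_right, he]
  induction j using ket_induction with
  | vacuum => simp [h (1, 0) (by simp [chargeValue])]
  | up m =>
    by_cases hm : m = n
    · simp [hm]
    · simp [hm, h (0, m) (by simpa [chargeValue] using hm)]
  | down m =>
    by_cases hm : m = n
    · simp [hm]
    · simp [hm, h (1, m + 1) (by simpa [chargeValue] using hm)]

theorem eq_smul_vacuum_of_inner_eq_zero {ψ : E}
    (h : ∀ j, chargeValue j ≠ 0 → inner ℂ (e j) ψ = 0) :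
    ψ = inner ℂ (e (1, 0)) ψ • e (1, 0) := by
  have he := orthonormal_iff_ite.1 e.orthonormal
  refine e.ext_inner fun j => ?_
  simp only [inner_smul_right, he]
  induction j using ket_induction with
  | vacuum => simp
  | up m => simp [h (0, m) (by simp [chargeValue])]
  | down m => simp [h (1, m + 1) (by simp [chargeValue])]

section Eigenspace

variable (hX : ∀ ψ φ : E, (ψ, φ) ∈ X.graph ↔
  ∀ j, inner ℂ (e j) φ = (chargeValue j : ℝ) * inner ℂ (e j) ψ)

include hX

theorem mem_eigenspace_iff {μ : ℤ} {ψ : E} :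
    ψ ∈ eigenspace X μ ↔ ∀ j, (chargeValue j : ℤ) ≠ μ → inner ℂ (e j) ψ = 0 := by
  change (ψ, (μ : ℂ) • ψ) ∈ X.graph ↔ _
  rw [hX]
  refine forall_congr' fun j => ?_
  rw [inner_smul_right, mul_eq_mul_right_iff, or_iff_not_imp_left]
  refine imp_congr (not_congr ?_) Iff.rfl
  rw [eq_comm, Complex.ofReal_natCast]
  norm_cast

theorem ket_mem_eigenspace (j : Fin 2 × ℕ) : e j ∈ eigenspace X (chargeValue j) :=
  (mem_eigenspace_iff hX).2 fun _ hk => e.inner_eq_zero_of_ne fun h => hk (by rw [h])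

/-- The basis of an eigenspace of the charge with a positive eigenvalue. -/
def eigenspaceBasis (n : ℕ) : Module.Basis (Fin 2) ℂ (eigenspace X ((n + 1 : ℕ) : ℤ)) :=
  Module.Basis.mk (v := ![⟨e (0, n), ket_mem_eigenspace hX (0, n)⟩,
      ⟨e (1, n + 1), ket_mem_eigenspace hX (1, n + 1)⟩])
    (by
      refine LinearIndependent.of_comp (eigenspace X ((n + 1 : ℕ) : ℤ)).subtype ?_
      have hcomp : (Subtype.val ∘ ![(⟨e (0, n), ket_mem_eigenspace hX (0, n)⟩ :
          eigenspace X ((n + 1 : ℕ) : ℤ)), ⟨e (1, n + 1), ket_mem_eigenspace hX (1, n + 1)⟩]) =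
          e ∘ (![(0, n), (1, n + 1)] : Fin 2 → Fin 2 × ℕ) := by
        ext i
        fin_cases i <;> rfl
      rw [Submodule.coe_subtype]
      exact hcomp ▸ e.orthonormal.linearIndependent.comp _
        (by intro i j; fin_cases i <;> fin_cases j <;> simp))
    (by
      rintro ⟨ψ, hψ⟩ _
      have h := eq_combination_of_inner_eq_zero (e := e) (n := n) (ψ := ψ) fun j hj =>
        (mem_eigenspace_iff hX).1 hψ j (by exact_mod_cast hj)
      rw [show (⟨ψ, hψ⟩ : eigenspace X ((n + 1 : ℕ) : ℤ)) =
        inner ℂ (e (0, n)) ψ • ⟨e (0, n), ket_mem_eigenspace hX (0, n)⟩ +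
        inner ℂ (e (1, n + 1)) ψ • ⟨e (1, n + 1), ket_mem_eigenspace hX (1, n + 1)⟩ from
          Subtype.ext h]
      exact Submodule.add_mem _ (Submodule.smul_mem _ _ (Submodule.subset_span ⟨0, rfl⟩))
        (Submodule.smul_mem _ _ (Submodule.subset_span ⟨1, rfl⟩)))

theorem eigenspaceBasis_zero (n : ℕ) : (eigenspaceBasis hX n 0 : E) = e (0, n) := by
  simp [eigenspaceBasis]

theorem eigenspaceBasis_one (n : ℕ) : (eigenspaceBasis hX n 1 : E) = e (1, n + 1) := by
  simp [eigenspaceBasis]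

theorem det_restrict_eq {U : E ≃ₗᵢ[ℂ] E} {n : ℕ} {a b c d : ℂ}
    (h0 : U (e (0, n)) = a • e (0, n) + c • e (1, n + 1))
    (h1 : U (e (1, n + 1)) = b • e (0, n) + d • e (1, n + 1))
    (h : ∀ ψ ∈ eigenspace X ((n + 1 : ℕ) : ℤ),
      (U.toLinearEquiv : E →ₗ[ℂ] E) ψ ∈ eigenspace X ((n + 1 : ℕ) : ℤ)) :
    LinearMap.det ((U.toLinearEquiv : E →ₗ[ℂ] E).restrict h) = a * d - b * c := by
  refine det_eq_of_basis_fin_two (eigenspaceBasis hX n) _ (Subtype.ext ?_)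
    (Subtype.ext ?_)
  · change U (eigenspaceBasis hX n 0 : E) =
      a • (eigenspaceBasis hX n 0 : E) + c • (eigenspaceBasis hX n 1 : E)
    rw [eigenspaceBasis_zero, eigenspaceBasis_one, h0]
  · change U (eigenspaceBasis hX n 1 : E) =
      b • (eigenspaceBasis hX n 0 : E) + d • (eigenspaceBasis hX n 1 : E)
    rw [eigenspaceBasis_zero, eigenspaceBasis_one, h1]

theorem blockDetEqOne_zero_iff {U : E ≃ₗᵢ[ℂ] E} {z : ℂ} (hz : U (e (1, 0)) = z • e (1, 0)) :
    BlockDetEqOne X 0 U ↔ U (e (1, 0)) = e (1, 0) := by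
  have hrep : ∀ ψ ∈ eigenspace X 0, ψ = inner ℂ (e (1, 0)) ψ • e (1, 0) := fun ψ hψ =>
    eq_smul_vacuum_of_inner_eq_zero fun j hj => (mem_eigenspace_iff hX).1 hψ j (by exact_mod_cast hj)
  have hU : ∀ ψ ∈ eigenspace X 0, U ψ = z • ψ := fun ψ hψ => by
    rw [hrep ψ hψ, map_smul, hz, smul_comm]
  have hinv : ∀ ψ ∈ eigenspace X 0, (U.toLinearEquiv : E →ₗ[ℂ] E) ψ ∈ eigenspace X 0 := by
    intro ψ hψ
    change U ψ ∈ _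
    rw [hU ψ hψ]
    exact Submodule.smul_mem _ _ hψ
  have hvac : e (1, 0) ∈ eigenspace X 0 := ket_mem_eigenspace hX (1, 0)
  have hne : e (1, 0) ≠ 0 := e.orthonormal.ne_zero _
  have hrank : Module.finrank ℂ (eigenspace X 0) = 1 := by
    refine finrank_eq_one (⟨e (1, 0), hvac⟩ : eigenspace X 0) (fun h => hne (congrArg Subtype.val h))
      fun ψ => ⟨_, Subtype.ext (hrep ψ ψ.2).symm⟩
  have hdet : LinearMap.det ((U.toLinearEquiv : E →ₗ[ℂ] E).restrict hinv) = z := by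
    have : (U.toLinearEquiv : E →ₗ[ℂ] E).restrict hinv = z • LinearMap.id := by
      ext ψ
      exact hU ψ ψ.2
    rw [this, LinearMap.det_smul, hrank, LinearMap.det_id, pow_one, mul_one]
  have hz1 : U (e (1, 0)) = e (1, 0) ↔ z = 1 := by
    rw [hz]
    exact ⟨fun h => smul_left_injective ℂ hne (by simpa using h), fun h => by rw [h, one_smul]⟩
  rw [hz1]
  exact ⟨fun ⟨_, h⟩ => hdet.symm.trans h, fun h => ⟨hinv, hdet.trans h⟩⟩

/-- Determinant conditions range over all integers `μ`; at negative ones the eigenspace is zero. -/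
theorem blockDetEqOne_of_neg {U : E ≃ₗᵢ[ℂ] E} {μ : ℤ} (hμ : μ < 0) : BlockDetEqOne X μ U := by
  have hbot : ∀ ψ ∈ eigenspace X μ, ψ = 0 := fun ψ hψ => e.ext_inner fun j => by
    rw [(mem_eigenspace_iff hX).1 hψ j (by omega), inner_zero_right]
  have : Subsingleton (eigenspace X μ) :=
    ⟨fun x y => Subtype.ext ((hbot x x.2).trans (hbot y y.2).symm)⟩
  refine ⟨fun ψ hψ => ?_, LinearMap.det_eq_one_of_subsingleton _⟩
  rw [hbot ψ hψ, map_zero]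
  exact Submodule.zero_mem _

theorem ActsAs.blockDetEqOne {U : E ≃ₗᵢ[ℂ] E} {n : ℕ} {q : ℍ[ℝ]} (hU : ActsAs e U n q) :
    BlockDetEqOne X ((n + 1 : ℕ) : ℤ) U := by
  have h : ∀ ψ ∈ eigenspace X ((n + 1 : ℕ) : ℤ),
      (U.toLinearEquiv : E →ₗ[ℂ] E) ψ ∈ eigenspace X ((n + 1 : ℕ) : ℤ) := by
    intro ψ hψ
    have hup := ket_mem_eigenspace hX (0, n)
    have hdown := ket_mem_eigenspace hX (1, n + 1)
    rw [eq_combination_of_inner_eq_zero (e := e) (n := n) (ψ := ψ) fun j hj =>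
      (mem_eigenspace_iff hX).1 hψ j (by exact_mod_cast hj)]
    change U _ ∈ _
    rw [map_add, map_smul, map_smul, hU.up, hU.down]
    exact Submodule.add_mem _
      (Submodule.smul_mem _ _ (Submodule.add_mem _ (Submodule.smul_mem _ _ hup)
        (Submodule.smul_mem _ _ hdown)))
      (Submodule.smul_mem _ _ (Submodule.add_mem _ (Submodule.smul_mem _ _ hup)
        (Submodule.smul_mem _ _ hdown)))
  refine ⟨h, (det_restrict_eq hX hU.up hU.down h).trans ?_⟩
  have := alpha_beta_normSq q
  rw [hU.norm_eq_one, one_pow, Complex.ofReal_one] at this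
  rw [← this]
  ring

/-- In a unitary 2 × 2 matrix of determinant one, the first column `(a, c)` determines the second as
`(-c̄, ā)`, which is the quaternion form. -/
theorem exists_actsAs_of_blockDetEqOne {U : E ≃ₗᵢ[ℂ] E} {n : ℕ}
    (hU : ∀ j k, chargeValue k ≠ chargeValue j → inner ℂ (e k) (U (e j)) = 0)
    (hdet : BlockDetEqOne X ((n + 1 : ℕ) : ℤ) U) : ∃ q, ActsAs e U n q := by
  have he := orthonormal_iff_ite.1 e.orthonormal
  have h0 := eq_combination_of_inner_eq_zero (e := e) (hU (0, n))
  have h1 := eq_combination_of_inner_eq_zero (e := e) (hU (1, n + 1))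
  set a := inner ℂ (e (0, n)) (U (e (0, n)))
  set c := inner ℂ (e (1, n + 1)) (U (e (0, n)))
  set b := inner ℂ (e (0, n)) (U (e (1, n + 1)))
  set d := inner ℂ (e (1, n + 1)) (U (e (1, n + 1)))
  obtain ⟨hinv, hd⟩ := hdet
  rw [det_restrict_eq hX h0 h1] at hd
  have hnorm := U.inner_map_map (e (0, n)) (e (0, n))
  have horth := U.inner_map_map (e (0, n)) (e (1, n + 1))
  rw [h0] at hnorm
  rw [h0, h1] at horth
  simp only [inner_add_left, inner_add_right, inner_smul_left, inner_smul_right, he,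
    Prod.mk.injEq] at hnorm horth
  simp at hnorm horth
  -- Orthogonality of the columns and the determinant condition are linear in `b, d`; the norm of
  -- the first column makes the system have determinant of modulus one.
  have hdeq : d = conj a := by
    linear_combination (-d) * hnorm + c * horth + conj a * hd
  have hbeq : b = -conj c := by
    linear_combination (-b) * hnorm + a * horth - conj c * hd
  obtain ⟨q, ha, hc⟩ := exists_alpha_beta a c
  exact ⟨q, by rw [ha, hc]; exact h0, by rw [ha, hc, ← hbeq, ← hdeq]; exact h1⟩

end Eigenspace

section Commutant

variable [CompleteSpace E]

/-- The unitary `exp (i t X)` generated by the charge. -/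
def chargeFlow (e : HilbertBasis (Fin 2 × ℕ) ℂ E) (t : ℝ) : E ≃ₗᵢ[ℂ] E :=
  e.diagonal fun j => t * (chargeValue j : ℝ)

/-- At time `π / δ`, with `δ` the difference of the two charges, the phases differ by the factor
`-1`, so the matrix element equals its own negative. -/
theorem inner_eq_zero_of_commute {U : E ≃ₗᵢ[ℂ] E}
    (hU : ∀ t, U * chargeFlow e t = chargeFlow e t * U) (j k : Fin 2 × ℕ)
    (hjk : chargeValue k ≠ chargeValue j) : inner ℂ (e k) (U (e j)) = 0 := by
  set δ : ℝ := (chargeValue k : ℝ) - chargeValue j with hδ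
  have hδ0 : δ ≠ 0 := sub_ne_zero.2 (by exact_mod_cast hjk)
  have h : U (chargeFlow e (Real.pi / δ) (e j)) = chargeFlow e (Real.pi / δ) (U (e j)) :=
    DFunLike.congr_fun (hU (Real.pi / δ)) (e j)
  have h2 := congrArg (inner ℂ (e k)) h
  rw [chargeFlow, HilbertBasis.diagonal_apply_self, map_smul, inner_smul_right,
    HilbertBasis.inner_diagonal, mul_eq_mul_right_iff] at h2
  refine h2.resolve_left fun h3 => ?_
  have h4 : Complex.exp (Complex.I * ↑(Real.pi / δ * chargeValue k)) =
      Complex.exp (Complex.I * ↑(Real.pi / δ * chargeValue j)) * Complex.exp (Real.pi * Complex.I) := by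
    rw [← Complex.exp_add]
    congr 1
    have : Real.pi / δ * chargeValue k = Real.pi / δ * chargeValue j + Real.pi := by
      field_simp
      rw [hδ]; ring
    rw [this]
    push_cast
    ring
  rw [← h3, Complex.exp_pi_mul_I] at h4
  have h5 := Complex.exp_ne_zero (Complex.I * ↑(Real.pi / δ * chargeValue j))
  apply h5
  linear_combination (1 / 2) * h4

theorem commute_of_mem_blockGroup {U : E ≃ₗᵢ[ℂ] E} (hU : U ∈ blockGroup e) (t : ℝ) :
    U * chargeFlow e t = chargeFlow e t * U := by
  obtain ⟨⟨z, hz⟩, hU⟩ := hU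
  have hX : ∀ j, chargeFlow e t (e j) = Complex.exp (Complex.I * ↑(t * (chargeValue j : ℝ))) • e j :=
    fun j => e.diagonal_apply_self _ j
  refine e.unitary_ext fun j => ?_
  change U (chargeFlow e t (e j)) = chargeFlow e t (U (e j))
  rw [hX, map_smul]
  induction j using ket_induction with
  | vacuum => rw [hz, map_smul, hX, smul_comm]
  | up n =>
    obtain ⟨q, hq⟩ := hU n
    rw [hq.up, map_add, map_smul, map_smul, hX, hX, smul_add, smul_comm, smul_comm _ (beta q)]
    rfl
  | down n =>
    obtain ⟨q, hq⟩ := hU n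
    rw [hq.down, map_add, map_smul, map_smul, hX, hX, smul_add, smul_comm,
      smul_comm _ (conj (alpha q))]
    rfl

end Commutant

end Charge

/-! ### Identification of the dynamical group. -/

section Main

variable {K : Type*} [NormedAddCommGroup K] [InnerProductSpace ℂ K] [CompleteSpace K]
  (b : HilbertBasis ℕ ℂ K)

theorem jointBasis_mem_graph {T : FiniteStates →ₗ[ℂ] FiniteStates} {j k : Fin 2 × ℕ} {c : ℂ}
    (h : T (finiteKet j) = c • finiteKet k) :
    (jointBasis b j, c • jointBasis b k) ∈ (onFiniteStates b T).graph := by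
  have := inclusion_mem_graph b T (finiteKet j)
  rwa [h, map_smul, inclusion_finiteKet, inclusion_finiteKet] at this

theorem spin_mem_graph (j : Fin 2 × ℕ) :
    (jointBasis b j, (spinValue j : ℂ) • jointBasis b j) ∈ (onFiniteStates b preJC1).graph := by
  refine jointBasis_mem_graph b ?_
  obtain ⟨i, n⟩ := j
  fin_cases i
  · simpa [spinValue] using preJC1_up n
  · simpa [spinValue] using preJC1_down n

theorem charge_mem_graph (j : Fin 2 × ℕ) :
    (jointBasis b j, ((chargeValue j : ℝ) : ℂ) • jointBasis b j) ∈
      (onFiniteStates b preCharge).graph :=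
  jointBasis_mem_graph b (by simpa using preCharge_finiteKet j)

/-- The coupling swaps the two vectors of a block with the same factor `√(n + 1)`, so their sum and
difference are eigenvectors with opposite eigenvalues. -/
theorem coupling_mem_graph (j : Fin 2 × ℕ) :
    (dressedBasis (jointBasis b) j, (couplingValue j : ℂ) • dressedBasis (jointBasis b) j) ∈
      (onFiniteStates b preJC2).graph := by
  rw [dressedBasis_apply]
  induction j using ket_induction with
  | vacuum =>
    have := jointBasis_mem_graph b (k := (1, 0)) (c := 0) (preJC2_vacuum.trans (zero_smul _ _).symm)
    simpa [couplingValue, dressedKet] using this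
  | up n =>
    have h := (onFiniteStates b preJC2).graph.smul_mem invSqrtTwo
      ((onFiniteStates b preJC2).graph.add_mem (jointBasis_mem_graph b (preJC2_up n))
        (jointBasis_mem_graph b (preJC2_down n)))
    convert h using 1
    ext1
    · rfl
    · simp only [couplingValue, dressedKet, Prod.smul_mk, Prod.mk_add_mk]
      module
  | down n =>
    have h := (onFiniteStates b preJC2).graph.smul_mem invSqrtTwo
      ((onFiniteStates b preJC2).graph.sub_mem (jointBasis_mem_graph b (preJC2_up n))
        (jointBasis_mem_graph b (preJC2_down n)))
    convert h using 1
    ext1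
    · rfl
    · simp only [couplingValue, dressedKet, Prod.smul_mk, Prod.mk_sub_mk]
      push_cast
      module

theorem mem_graph_charge_iff (ψ φ : Atom ⊗[ℂ] K) : (ψ, φ) ∈ (charge b).graph ↔
    ∀ j, inner ℂ (jointBasis b j) φ = (chargeValue j : ℝ) * inner ℂ (jointBasis b j) ψ :=
  (jointBasis b).mem_graph_closure_iff (domain_onFiniteStates b _).le (charge_mem_graph b) ψ φ

/-- The definition quantifies over all exponential groups of the charge: existence of `chargeFlow`
as one gives one direction, its uniqueness the other. -/
theorem mem_unitariesCommutingWith_iff {U : (Atom ⊗[ℂ] K) ≃ₗᵢ[ℂ] (Atom ⊗[ℂ] K)} :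
    U ∈ unitariesCommutingWith (charge b) ↔
      ∀ t, U * chargeFlow (jointBasis b) t = chargeFlow (jointBasis b) t * U := by
  constructor
  · intro h
    exact h _ ((jointBasis b).isExpGroup_diagonal (domain_onFiniteStates b _).le
      (charge_mem_graph b))
  · intro h V hV t
    rw [(jointBasis b).eq_diagonal_of_isExpGroup (charge_mem_graph b) hV t]
    exact h t

/-- Uniqueness of the exponential groups makes `blockGroup` one of the competing subgroups; their
existence puts both flows into every competitor. -/
theorem dynamicalGroup_hamiltonian :
    dynamicalGroup (hamiltonian b) = blockGroup (jointBasis b) := by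
  have hdom : (onFiniteStates b preJC2).domain ≤
      Submodule.span ℂ (Set.range (dressedBasis (jointBasis b))) := by
    rw [domain_onFiniteStates, ← span_range_dressedKet]
    exact (congrArg (fun v => Submodule.span ℂ (Set.range v))
      (funext (dressedBasis_apply (jointBasis b)))).ge
  apply le_antisymm
  · refine sInf_le ⟨isStronglyClosed_blockGroup _, fun k V hV t => ?_⟩
    fin_cases k
    · rw [(jointBasis b).eq_diagonal_of_isExpGroup (spin_mem_graph b) hV t]
      exact spinFlow_mem_blockGroup t
    · rw [(dressedBasis (jointBasis b)).eq_diagonal_of_isExpGroup (coupling_mem_graph b) hV t]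
      exact couplingFlow_mem_blockGroup t
  · refine le_sInf fun G hG => blockGroup_le hG.1 ?_ ?_
    · exact hG.2 0 _ ((jointBasis b).isExpGroup_diagonal (domain_onFiniteStates b _).le
        (spin_mem_graph b))
    · exact hG.2 1 _ ((dressedBasis (jointBasis b)).isExpGroup_diagonal hdom
        (coupling_mem_graph b))

theorem mem_blockGroup_iff {U : (Atom ⊗[ℂ] K) ≃ₗᵢ[ℂ] (Atom ⊗[ℂ] K)} :
    U ∈ blockGroup (jointBasis b) ↔ U ∈ unitariesCommutingWith (charge b) ∧
      ∀ μ : ℤ, μ ≠ 0 → BlockDetEqOne (charge b) μ U := by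
  have hX := mem_graph_charge_iff b
  constructor
  · intro hU
    refine ⟨(mem_unitariesCommutingWith_iff b).2 (commute_of_mem_blockGroup hU), fun μ hμ => ?_⟩
    rcases lt_or_gt_of_ne hμ with h | h
    · exact blockDetEqOne_of_neg hX h
    · obtain ⟨n, rfl⟩ : ∃ n : ℕ, μ = ((n + 1 : ℕ) : ℤ) := ⟨(μ - 1).toNat, by omega⟩
      obtain ⟨q, hq⟩ := hU.2 n
      exact hq.blockDetEqOne hX
  · rintro ⟨hU, hdet⟩
    have h := inner_eq_zero_of_commute ((mem_unitariesCommutingWith_iff b).1 hU)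
    refine ⟨⟨_, eq_smul_vacuum_of_inner_eq_zero (h (1, 0))⟩, fun n => ?_⟩
    exact exists_actsAs_of_blockDetEqOne hX h (hdet _ (by omega))

end Main
end JaynesCummings
end

theorem mainTheorem4 {K : Type*} [NormedAddCommGroup K] [InnerProductSpace ℂ K] [CompleteSpace K]
    (b : HilbertBasis ℕ ℂ K) :
    (JaynesCummings.dynamicalGroup (JaynesCummings.hamiltonian b) :
        Set ((JaynesCummings.Atom ⊗[ℂ] K) ≃ₗᵢ[ℂ] (JaynesCummings.Atom ⊗[ℂ] K))) =
      {U | U ∈ JaynesCummings.unitariesCommutingWith (JaynesCummings.charge b) ∧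
        ∀ μ : ℤ, μ ≠ 0 → JaynesCummings.BlockDetEqOne (JaynesCummings.charge b) μ U} ∧
    JaynesCummings.specialUnitaries (JaynesCummings.charge b) =
      {U | U ∈ JaynesCummings.dynamicalGroup (JaynesCummings.hamiltonian b) ∧
        U (JaynesCummings.vacuum b) = JaynesCummings.vacuum b} := by
  have hvac : JaynesCummings.vacuum b = JaynesCummings.jointBasis b (1, 0) :=
    (JaynesCummings.jointBasis_apply b (1, 0)).symm
  rw [JaynesCummings.dynamicalGroup_hamiltonian]
  refine ⟨Set.ext fun U => JaynesCummings.mem_blockGroup_iff b, Set.ext fun U => ?_⟩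
  rw [hvac]
  constructor
  · rintro ⟨hU, hdet⟩
    -- The two groups differ only in the condition at `μ = 0`, where the block is one-dimensional
    -- and determinant one means fixing the vacuum.
    have hmem := (JaynesCummings.mem_blockGroup_iff b).2 ⟨hU, fun μ _ => hdet μ⟩
    obtain ⟨z, hz⟩ := hmem.1
    exact ⟨hmem, (JaynesCummings.blockDetEqOne_zero_iff
      (JaynesCummings.mem_graph_charge_iff b) hz).1 (hdet 0)⟩
  · rintro ⟨hmem, hfix⟩
    obtain ⟨hU, hdet⟩ := (JaynesCummings.mem_blockGroup_iff b).1 hmem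
    obtain ⟨z, hz⟩ := hmem.1
    refine ⟨hU, fun μ => ?_⟩
    rcases eq_or_ne μ 0 with rfl | hμ
    · exact (JaynesCummings.blockDetEqOne_zero_iff (JaynesCummings.mem_graph_charge_iff b) hz).2 hfix
    · exact hdet μ hμ
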